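/- Consider the two-user fading vector multiple access channel $\mathbf y=\mathbf h_1x_1+\mathbf h_2x_2+\mathbf z$ with $N_r\ge 1$ receive antennas, noise covariance $\sigma^2\mathbf I$ with $\sigma^2>0$, channel vectors $\mathbf h_1,\mathbf h_2\in\mathbb R^{N_r}$ known to everybody, whose joint (stationary) law has a density with respect to Lebesgue measure and satisfies $E\log(1+\|\mathbf h_i\|^2)<\infty$, $i=1,2$. Let $\bar P_1,\bar P_2>0$, and let $\mathcal F_i$ be the set of measurable power control policies $\mathcal P_i(\mathbf h_1,\mathbf h_2)\ge 0$ with $E[\mathcal P_i]\le\bar P_i$. Policies that agree almost surely are identified. A base-station strategy is a measurable set $D_1$ of fading states $(\mathbf h_1,\mathbf h_2)$: user 1 is decoded first on $D_1$, user 2 is decoded first on $D_1^c$. In the low-level game user $i$ chooses $\mathcal P_i\in\mathcal F_i$ and has payoff $$\bar R_1(D_1,\mathcal P_1,\mathcal P_2)=E\Big[\tfrac12\log_2\frac{\det(\sigma^2\mathbf I+\mathcal P_1\mathbf h_1\mathbf h_1^T+I_{D_1}\mathcal P_2\mathbf h_2\mathbf h_2^T)}{\det(\sigma^2\mathbf I+I_{D_1}\mathcal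 P_2\mathbf h_2\mathbf h_2^T)}\Big],\qquad \bar R_2(D_1,\mathcal P_1,\mathcal P_2)=E\Big[\tfrac12\log_2\frac{\det(\sigma^2\mathbf I+I_{D_1^c}\mathcal P_1\mathbf h_1\mathbf h_1^T+\mathcal P_2\mathbf h_2\mathbf h_2^T)}{\det(\sigma^2\mathbf I+I_{D_1^c}\mathcal P_1\mathbf h_1\mathbf h_1^T)}\Big].$$ A Nash equilibrium is admissible if no other Nash equilibrium is at least as good for both users and strictly better for at least one. The rate pairs achieved by the Stackelberg game are the pairs $(\bar R_1,\bar R_2)$ at admissible Nash equilibria of the low-level games, over all $D_1$. With $J(\mathcal P_1,\mathcal P_2)=E\big[\tfrac12\log_2\det\big(\mathbf I+\sigma^{-2}(\mathcal P_1\mathbf h_1\mathbf h_1^T+\mathcal P_2\mathbf h_2\mathbf h_2^T)\big)\big]$, the capacity region is $$\mathcal G_c=\bigcup_{\mathcal P_1\in\mathcal F_1,\,\mathcal P_2\in\mathcal F_2}\{(R_1,R_2):R_1,R_2\ge0,\ R_1\le J(\mathcal P_1,0),\ R_2\le J(0,\mathcal P_2),\ R_1+R_2\le J(\mathcal P_1,\mathcal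 P_2)\}.$$ Its corner point $CR_i$ is the point at which $R_i$ is maximal over $\mathcal G_c$ and the other rate is the largest one compatible with this; its maximum sum-rate points are the points of $\mathcal G_c$ that maximize $R_1+R_2$ over $\mathcal G_c$. Then: 1. For every base-station strategy $D_1$ the low-level game has exactly one admissible Nash equilibrium. 2. The Stackelberg game achieves both corner points $CR_1$ and $CR_2$. 3. Maximum sum-rate points exist. If, for some $D_1$, the rate pair at the admissible Nash equilibrium is a maximum sum-rate point, then at this equilibrium almost surely at most one user transmits in each fading state. If moreover $N_r\ge2$ and there are nonempty connected open sets $U_1,U_2\subset\mathbb R^{N_r}$ such that, up to null sets, the density of $(\mathbf h_1,\mathbf h_2)$ is positive exactly on $U_1\times U_2$, then the Stackelberg game achieves no maximum sum-rate point. -/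

import Mathlib

open MeasureTheory

noncomputable section

/-- A joint fading state `(h₁, h₂)`: the channel vectors of users 1 and 2 at `n` receive
antennas. -/
abbrev FadingState (n : ℕ) : Type :=
  EuclideanSpace ℝ (Fin n) × EuclideanSpace ℝ (Fin n)

/-- The data of a two-user fading vector multiple access channel with `n` receive antennas:
the (stationary) joint law of the fading vectors, the noise variance `σ²` per antenna, and the
average power constraints of the two users. -/
structure VectorMAC (n : ℕ) where
  law : Measure (FadingState n)
  noiseVar : ℝ
  power₁ : ℝ
  power₂ : ℝ

namespace VectorMAC

variable {n : ℕ} (C : VectorMAC n)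

/-- `σ² I + p h₁ h₁ᵀ + q h₂ h₂ᵀ`. -/
def receivedCov (p q : ℝ) (H : FadingState n) : Matrix (Fin n) (Fin n) ℝ :=
  C.noiseVar • (1 : Matrix (Fin n) (Fin n) ℝ)
    + p • Matrix.vecMulVec (fun k => H.1 k) (fun k => H.1 k)
    + q • Matrix.vecMulVec (fun k => H.2 k) (fun k => H.2 k)

/-- Feasible power control policies for an average power constraint `Pbar`. -/
structure IsFeasible (Pbar : ℝ) (P : FadingState n → ℝ) : Prop where
  measurable : Measurable P
  nonneg : ∀ H, 0 ≤ P H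
  integrable : Integrable P C.law
  average_le : ∫ H, P H ∂C.law ≤ Pbar

/-- Payoff of user 1. User 1 is decoded first on `D`, so the signal of user 2 is interference
for user 1 exactly on `D`. -/
def rate₁ (D : Set (FadingState n)) (P₁ P₂ : FadingState n → ℝ) : ℝ :=
  ∫ H, ((1 / 2) * Real.logb 2 (C.receivedCov (P₁ H) (D.indicator P₂ H) H).det
      - (1 / 2) * Real.logb 2 (C.receivedCov 0 (D.indicator P₂ H) H).det) ∂C.law

/-- Payoff of user 2. User 2 is decoded first on `Dᶜ`, so the signal of user 1 is interference
for user 2 exactly on `Dᶜ`. -/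
def rate₂ (D : Set (FadingState n)) (P₁ P₂ : FadingState n → ℝ) : ℝ :=
  ∫ H, ((1 / 2) * Real.logb 2 (C.receivedCov (Dᶜ.indicator P₁ H) (P₂ H) H).det
      - (1 / 2) * Real.logb 2 (C.receivedCov (Dᶜ.indicator P₁ H) 0 H).det) ∂C.law

/-- Nash equilibria of the low-level game, given the base-station strategy `D`. -/
structure IsNash (D : Set (FadingState n)) (P₁ P₂ : FadingState n → ℝ) : Prop where
  feasible₁ : C.IsFeasible C.power₁ P₁
  feasible₂ : C.IsFeasible C.power₂ P₂
  best₁ : ∀ Q₁, C.IsFeasible C.power₁ Q₁ → C.rate₁ D Q₁ P₂ ≤ C.rate₁ D P₁ P₂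
  best₂ : ∀ Q₂, C.IsFeasible C.power₂ Q₂ → C.rate₂ D P₁ Q₂ ≤ C.rate₂ D P₁ P₂

/-- A Nash equilibrium is admissible if no Nash equilibrium is at least as good for both users
and strictly better for one of them. -/
def IsAdmissibleNash (D : Set (FadingState n)) (P₁ P₂ : FadingState n → ℝ) : Prop :=
  C.IsNash D P₁ P₂ ∧
    ¬ ∃ Q₁ Q₂, C.IsNash D Q₁ Q₂ ∧
      C.rate₁ D P₁ P₂ ≤ C.rate₁ D Q₁ Q₂ ∧ C.rate₂ D P₁ P₂ ≤ C.rate₂ D Q₁ Q₂ ∧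
      (C.rate₁ D P₁ P₂ < C.rate₁ D Q₁ Q₂ ∨ C.rate₂ D P₁ P₂ < C.rate₂ D Q₁ Q₂)

/-- The Stackelberg achievable region: rate pairs at admissible Nash equilibria of the low-level
game, over all base-station strategies `D`. -/
def stackelbergRegion : Set (ℝ × ℝ) :=
  {r | ∃ (D : Set (FadingState n)) (P₁ P₂ : FadingState n → ℝ), MeasurableSet D ∧
    C.IsAdmissibleNash D P₁ P₂ ∧ r = (C.rate₁ D P₁ P₂, C.rate₂ D P₁ P₂)}

/-- `E[½ log₂ det (I + (P₁ h₁ h₁ᵀ + P₂ h₂ h₂ᵀ) / σ²)]`. -/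
def sumInfo (P₁ P₂ : FadingState n → ℝ) : ℝ :=
  ∫ H, (1 / 2) * Real.logb 2
    ((1 : Matrix (Fin n) (Fin n) ℝ) + C.noiseVar⁻¹ •
      (P₁ H • Matrix.vecMulVec (fun k => H.1 k) (fun k => H.1 k)
        + P₂ H • Matrix.vecMulVec (fun k => H.2 k) (fun k => H.2 k))).det ∂C.law

/-- The capacity region with channel state information at the transmitters and the receiver:
the union over feasible power control policies of the ergodic multiple-access pentagons. -/
def capacityRegion : Set (ℝ × ℝ) :=
  {r | 0 ≤ r.1 ∧ 0 ≤ r.2 ∧ ∃ P₁ P₂ : FadingState n → ℝ,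
    C.IsFeasible C.power₁ P₁ ∧ C.IsFeasible C.power₂ P₂ ∧
    r.1 ≤ C.sumInfo P₁ 0 ∧ r.2 ≤ C.sumInfo 0 P₂ ∧ r.1 + r.2 ≤ C.sumInfo P₁ P₂}

/-- The corner point at which user 1 has the largest rate in the capacity region and user 2 has
the largest rate compatible with this. -/
def IsCornerPoint₁ (r : ℝ × ℝ) : Prop :=
  r ∈ C.capacityRegion ∧
    ∀ s ∈ C.capacityRegion, s.1 ≤ r.1 ∧ (s.1 = r.1 → s.2 ≤ r.2)

/-- The corner point at which user 2 has the largest rate in the capacity region and user 1 has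
the largest rate compatible with this. -/
def IsCornerPoint₂ (r : ℝ × ℝ) : Prop :=
  r ∈ C.capacityRegion ∧
    ∀ s ∈ C.capacityRegion, s.2 ≤ r.2 ∧ (s.2 = r.2 → s.1 ≤ r.1)

/-- The points of the capacity region at which the sum of the rates is maximal. -/
def IsMaxSumRatePoint (r : ℝ × ℝ) : Prop :=
  r ∈ C.capacityRegion ∧ ∀ s ∈ C.capacityRegion, s.1 + s.2 ≤ r.1 + r.2

/-- Up to null sets, the fading density is positive exactly on a product of two nonempty
connected open sets of channel vectors. -/
def HasConnectedProductSupport : Prop :=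
  ∃ U₁ U₂ : Set (EuclideanSpace ℝ (Fin n)),
    IsOpen U₁ ∧ IsConnected U₁ ∧ IsOpen U₂ ∧ IsConnected U₂ ∧
    C.law (U₁ ×ˢ U₂)ᶜ = 0 ∧ (volume.restrict (U₁ ×ˢ U₂)) ≪ C.law

end VectorMAC

end

/-!
Only three functions of the fading state matter: the gains `a = ‖h₁‖² / σ²`, `b = ‖h₂‖² / σ²` and
the Gram determinant `d`, since `det (I + σ⁻² (p h₁ h₁ᵀ + q h₂ h₂ᵀ)) = 1 + p a + q b + p q d`.
Against a fixed opponent the unique best response is water-filling over the effective gain.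

*Equilibria.* In each fading state only the user decoded first suffers interference, so an
equilibrium is determined by its two water levels: the user decoded second fills its own gain up to
its level, and the other one fills what remains. Raising a level raises the interference on the
other user, hence the feasible pairs of levels are closed and stable under infima; the least pair
is an equilibrium which is best for both users.
For `D = ∅` and `D = univ` it is the corner point of the user who never suffers interference.

*Maximal sum-rate.* A maximizer of the joint rate is, for both users, a best response to full
interference. An equilibrium of the game is also a best response to the actual one, so the user who
is decoded second has both a level without and a level with interference. Where both users
transmit, these levels force a polynomial relation between `a`, `b` and `d`, which a density
excludes; hence at most one user transmits. The optimality conditions then say that in almost every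
state the transmitting user silences the other one. With connected product support there
is a state at which the two scaled gains agree and exceed the noise, and with two antennas
`h₁` can be turned away from `h₂` there: then neither user silences the other. Maximizers exist
because a maximizing sequence has convex combinations along which the strictly convex functional
`∫ exp (-P)` is almost minimal, so that they converge almost everywhere.
-/

namespace FadingMAC

/-! ### Water-filling -/

/-- The water-filling power `(ν - 1 / g)⁺` at water level `ν` over a channel with gain `g`. -/
noncomputable def waterfill (ν g : ℝ) : ℝ := max (ν - g⁻¹) 0

section waterfill

variable {ν ν' g g' q : ℝ}

lemma waterfill_nonneg (ν g : ℝ) : 0 ≤ waterfill ν g := le_max_right _ _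

lemma waterfill_mono_level (h : ν ≤ ν') (g : ℝ) : waterfill ν g ≤ waterfill ν' g :=
  max_le_max (sub_le_sub_right h _) le_rfl

lemma waterfill_mono_gain (ν : ℝ) (hg : 0 < g) (h : g ≤ g') : waterfill ν g ≤ waterfill ν g' :=
  max_le_max (sub_le_sub_left (inv_anti₀ hg h) _) le_rfl

lemma waterfill_eq_zero_iff : waterfill ν g = 0 ↔ ν ≤ g⁻¹ := by
  rw [waterfill, max_eq_right_iff, sub_nonpos]

lemma waterfill_of_nonpos (hν : ν ≤ 0) (hg : 0 ≤ g) : waterfill ν g = 0 :=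
  waterfill_eq_zero_iff.2 (hν.trans (inv_nonneg.2 hg))

lemma waterfill_eq_of_pos (h : 0 < waterfill ν g) : waterfill ν g = ν - g⁻¹ :=
  max_eq_left (le_of_not_ge fun h' => h.ne' (max_eq_right h'))

lemma waterfill_le_abs (hg : 0 ≤ g) : waterfill ν g ≤ |ν| :=
  max_le ((sub_le_self _ (inv_nonneg.2 hg)).trans (le_abs_self ν)) (abs_nonneg ν)

lemma abs_waterfill_le (hg : 0 ≤ g) : |waterfill ν g| ≤ |ν| := by
  rw [abs_of_nonneg (waterfill_nonneg ν g)]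
  exact waterfill_le_abs hg

lemma measurable_waterfill {Ω : Type*} [MeasurableSpace Ω] (ν : ℝ) {g : Ω → ℝ}
    (hg : Measurable g) : Measurable fun ω => waterfill ν (g ω) :=
  (measurable_const.sub hg.inv).max measurable_const

/-- The Karush–Kuhn–Tucker condition: the marginal rate `g / (1 + w g)` at the water-filling power
`w` is the price `1 / ν`, or less than it if `w = 0`. -/
lemma sub_waterfill_mul_le_div (hν : 0 < ν) (hg : 0 < g) (hq : 0 ≤ q) :
    (q - waterfill ν g) * (g / (1 + waterfill ν g * g)) ≤ (q - waterfill ν g) / ν := by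
  rcases (waterfill_nonneg ν g).eq_or_lt with hw | hw
  · have hgν : g ≤ ν⁻¹ := (le_inv_comm₀ hν hg).1 (waterfill_eq_zero_iff.1 hw.symm)
    simpa [← hw, div_eq_mul_inv] using mul_le_mul_of_nonneg_left hgν hq
  · have hmarginal : g / (1 + waterfill ν g * g) = ν⁻¹ := by
      rw [waterfill_eq_of_pos hw]
      field_simp
      ring
    rw [hmarginal, div_eq_mul_inv]

lemma log_one_add_mul_lt_waterfill_add (hν : 0 < ν) (hg : 0 < g) (hq : 0 ≤ q)
    (hne : q ≠ waterfill ν g) :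
    Real.log (1 + q * g) < Real.log (1 + waterfill ν g * g) + (q - waterfill ν g) / ν := by
  have hkkt := sub_waterfill_mul_le_div hν hg hq
  have hw := waterfill_nonneg ν g
  set w := waterfill ν g
  have hw' : 0 < 1 + w * g := by positivity
  have hq' : 0 < 1 + q * g := by positivity
  have hratio : (1 + q * g) / (1 + w * g) - 1 = (q - w) * (g / (1 + w * g)) := by
    field_simp
    ring
  have hratio_ne : (1 + q * g) / (1 + w * g) ≠ 1 := by
    rw [Ne, ← sub_eq_zero, hratio]
    exact mul_ne_zero (sub_ne_zero.2 hne) (by positivity)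
  have hlog := Real.log_lt_sub_one_of_pos (div_pos hq' hw') hratio_ne
  rw [Real.log_div hq'.ne' hw'.ne'] at hlog
  linarith

lemma log_one_add_mul_le_waterfill_add (hν : 0 < ν) (hg : 0 < g) (hq : 0 ≤ q) :
    Real.log (1 + q * g) ≤ Real.log (1 + waterfill ν g * g) + (q - waterfill ν g) / ν := by
  rcases eq_or_ne q (waterfill ν g) with rfl | hne
  · simp
  · exact (log_one_add_mul_lt_waterfill_add hν hg hq hne).le

end waterfill

lemma log_one_add_nonneg {p : ℝ} (hp : 0 ≤ p) : 0 ≤ Real.log (1 + p) :=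
  Real.log_nonneg (by linarith)

lemma log_one_add_le_self {p : ℝ} (hp : 0 ≤ p) : Real.log (1 + p) ≤ p := by
  linarith [Real.log_le_sub_one_of_pos (show 0 < 1 + p by linarith)]

lemma log_one_add_mul_le {p g : ℝ} (hp : 0 ≤ p) (hg : 0 ≤ g) :
    Real.log (1 + p * g) ≤ Real.log (1 + p) + Real.log (1 + g) := by
  rw [← Real.log_mul (by positivity) (by positivity)]
  exact Real.log_le_log (by positivity) (by linarith)

/-! ### The single-user channel -/

section singleUser

variable {Ω : Type*} [MeasurableSpace Ω]

/-- Measurable power policies with average power at most `c`; this is `VectorMAC.IsFeasible` over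
an arbitrary space of fading states. -/
structure IsPolicy (μ : Measure Ω) (c : ℝ) (P : Ω → ℝ) : Prop where
  measurable : Measurable P
  nonneg : ∀ ω, 0 ≤ P ω
  integrable : Integrable P μ
  average_le : ∫ ω, P ω ∂μ ≤ c

/-- Power gains of a fading channel: almost surely positive, with integrable logarithm, so that
all policies have a finite rate. -/
structure IsGain (μ : Measure Ω) (g : Ω → ℝ) : Prop where
  measurable : Measurable g
  nonneg : ∀ ω, 0 ≤ g ω
  pos : ∀ᵐ ω ∂μ, 0 < g ω
  integrable_log : Integrable (fun ω => Real.log (1 + g ω)) μ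

/-- The rate `E[log (1 + P g)]`, up to a factor, of the policy `P` over a channel with gain `g`. -/
noncomputable def logValue (μ : Measure Ω) (g P : Ω → ℝ) : ℝ :=
  ∫ ω, Real.log (1 + P ω * g ω) ∂μ

/-- `P` maximizes the rate over a channel with gain `g` among the policies with average power at
most `c`. -/
structure IsBestResponse (μ : Measure Ω) (c : ℝ) (g P : Ω → ℝ) : Prop where
  isPolicy : IsPolicy μ c P
  le : ∀ Q, IsPolicy μ c Q → logValue μ g Q ≤ logValue μ g P

variable {μ : Measure Ω} {c ν : ℝ} {g g' P Q : Ω → ℝ}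

lemma isPolicy_zero (hc : 0 ≤ c) : IsPolicy μ c (0 : Ω → ℝ) :=
  ⟨measurable_const, fun _ => le_rfl, integrable_zero _ _ _, by simpa using hc⟩

lemma IsGain.integrable_log_one_add_mul (hg : IsGain μ g) (hP : IsPolicy μ c P) :
    Integrable (fun ω => Real.log (1 + P ω * g ω)) μ := by
  refine (hP.integrable.add hg.integrable_log).mono'
    (((hP.measurable.mul hg.measurable).const_add 1).log.aestronglyMeasurable)
    (.of_forall fun ω => ?_)
  rw [Real.norm_eq_abs, abs_of_nonneg (log_one_add_nonneg (mul_nonneg (hP.nonneg ω) (hg.nonneg ω)))]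
  exact (log_one_add_mul_le (hP.nonneg ω) (hg.nonneg ω)).trans
    (add_le_add_left (log_one_add_le_self (hP.nonneg ω)) _)

lemma logValue_nonneg (hg : ∀ ω, 0 ≤ g ω) (hP : ∀ ω, 0 ≤ P ω) : 0 ≤ logValue μ g P :=
  integral_nonneg fun ω => log_one_add_nonneg (mul_nonneg (hP ω) (hg ω))

lemma logValue_congr (hg : g =ᵐ[μ] g') (hP : P =ᵐ[μ] Q) : logValue μ g P = logValue μ g' Q := by
  refine integral_congr_ae ?_
  filter_upwards [hg, hP] with ω hgω hPω
  rw [hgω, hPω]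

lemma logValue_mono_gain (hg : IsGain μ g) (hg' : IsGain μ g') (h : g ≤ᵐ[μ] g')
    (hP : IsPolicy μ c P) : logValue μ g P ≤ logValue μ g' P := by
  refine integral_mono_ae (hg.integrable_log_one_add_mul hP) (hg'.integrable_log_one_add_mul hP) ?_
  filter_upwards [h] with ω h
  have hPg := mul_nonneg (hP.nonneg ω) (hg.nonneg ω)
  exact Real.log_le_log (by linarith) (by gcongr; exact hP.nonneg ω)

lemma IsBestResponse.congr_gain (hP : IsBestResponse μ c g P) (h : g =ᵐ[μ] g') :
    IsBestResponse μ c g' P :=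
  ⟨hP.isPolicy, fun Q hQ => by
    simpa only [logValue_congr h (ae_eq_refl _)] using hP.le Q hQ⟩

lemma log_one_add_mul_ae_le_lagrangian (hν : 0 < ν) (hg : IsGain μ g) (hQ : ∀ ω, 0 ≤ Q ω) :
    (fun ω => Real.log (1 + Q ω * g ω)) ≤ᵐ[μ]
      fun ω => Real.log (1 + waterfill ν (g ω) * g ω) + (Q ω - waterfill ν (g ω)) / ν := by
  filter_upwards [hg.pos] with ω hω
  exact log_one_add_mul_le_waterfill_add hν hω (hQ ω)

lemma integral_waterfill_of_nonpos (hg : ∀ ω, 0 ≤ g ω) (hν : ν ≤ 0) :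
    ∫ ω, waterfill ν (g ω) ∂μ = 0 := by
  simp only [waterfill_of_nonpos hν (hg _), integral_zero]

lemma exists_nat_measure_inter_le_ne_zero {A : Set Ω} (hA : μ A ≠ 0) (f : Ω → ℝ) :
    ∃ k : ℕ, μ (A ∩ {ω | f ω ≤ k}) ≠ 0 := by
  by_contra! h
  refine hA (measure_mono_null (fun ω hω => ?_) (measure_iUnion_null h))
  obtain ⟨k, hk⟩ := exists_nat_ge (f ω)
  exact Set.mem_iUnion.2 ⟨k, hω, hk⟩

lemma integrable_waterfill [IsFiniteMeasure μ] (ν : ℝ) (hg : IsGain μ g) :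
    Integrable (fun ω => waterfill ν (g ω)) μ :=
  (integrable_const |ν|).mono' (measurable_waterfill ν hg.measurable).aestronglyMeasurable
    (.of_forall fun ω => abs_waterfill_le (hg.nonneg ω))

lemma isPolicy_waterfill [IsFiniteMeasure μ] (hg : IsGain μ g)
    (h : ∫ ω, waterfill ν (g ω) ∂μ = c) : IsPolicy μ c fun ω => waterfill ν (g ω) :=
  ⟨measurable_waterfill ν hg.measurable, fun _ => waterfill_nonneg _ _,
    integrable_waterfill ν hg, h.le⟩

section optimality

variable [IsFiniteMeasure μ]

lemma integrable_log_waterfill (ν : ℝ) (hg : IsGain μ g) :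
    Integrable (fun ω => Real.log (1 + waterfill ν (g ω) * g ω)) μ :=
  hg.integrable_log_one_add_mul (isPolicy_waterfill hg rfl)

lemma integrable_lagrangian (ν : ℝ) (hg : IsGain μ g) (hQ : Integrable Q μ) :
    Integrable (fun ω => Real.log (1 + waterfill ν (g ω) * g ω)
      + (Q ω - waterfill ν (g ω)) / ν) μ :=
  (integrable_log_waterfill ν hg).add ((hQ.sub (integrable_waterfill ν hg)).div_const ν)

lemma integral_lagrangian (ν : ℝ) (hg : IsGain μ g) (hQ : Integrable Q μ) :
    ∫ ω, (Real.log (1 + waterfill ν (g ω) * g ω) + (Q ω - waterfill ν (g ω)) / ν) ∂μ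
      = logValue μ g (fun ω => waterfill ν (g ω))
        + (∫ ω, Q ω ∂μ - ∫ ω, waterfill ν (g ω) ∂μ) / ν := by
  have hW := integrable_waterfill ν hg
  have hslack : ∫ ω, (Q ω - waterfill ν (g ω)) / ν ∂μ
      = (∫ ω, Q ω ∂μ - ∫ ω, waterfill ν (g ω) ∂μ) / ν := by
    rw [integral_div, integral_sub hQ hW]
  rw [← hslack]
  exact integral_add (integrable_log_waterfill ν hg) ((hQ.sub hW).div_const ν)

lemma logValue_le_logValue_waterfill (hν : 0 < ν) (hg : IsGain μ g)
    (hc : ∫ ω, waterfill ν (g ω) ∂μ = c) (hQ : IsPolicy μ c Q) :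
    logValue μ g Q ≤ logValue μ g fun ω => waterfill ν (g ω) := by
  have hle := integral_mono_ae (hg.integrable_log_one_add_mul hQ)
    (integrable_lagrangian ν hg hQ.integrable) (log_one_add_mul_ae_le_lagrangian hν hg hQ.nonneg)
  rw [integral_lagrangian ν hg hQ.integrable, hc] at hle
  have hslack : (∫ ω, Q ω ∂μ - c) / ν ≤ 0 :=
    div_nonpos_of_nonpos_of_nonneg (sub_nonpos.2 hQ.average_le) hν.le
  exact hle.trans (by linarith)

lemma ae_eq_waterfill_of_logValue_le (hν : 0 < ν) (hg : IsGain μ g)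
    (hc : ∫ ω, waterfill ν (g ω) ∂μ = c) (hQ : IsPolicy μ c Q)
    (h : logValue μ g (fun ω => waterfill ν (g ω)) ≤ logValue μ g Q) :
    Q =ᵐ[μ] fun ω => waterfill ν (g ω) := by
  have hslack : (∫ ω, Q ω ∂μ - c) / ν ≤ 0 :=
    div_nonpos_of_nonpos_of_nonneg (sub_nonpos.2 hQ.average_le) hν.le
  have hle := log_one_add_mul_ae_le_lagrangian hν hg hQ.nonneg
  have hi := hg.integrable_log_one_add_mul hQ
  have hi' := integrable_lagrangian ν hg hQ.integrable
  have heq := (integral_eq_iff_of_ae_le hi hi' hle).1 (le_antisymm (integral_mono_ae hi hi' hle) (by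
    rw [integral_lagrangian ν hg hQ.integrable, hc]
    change _ ≤ logValue μ g Q
    linarith))
  filter_upwards [heq, hg.pos] with ω hω hpos
  by_contra hne
  exact (log_one_add_mul_lt_waterfill_add hν hpos (hQ.nonneg ω) hne).ne hω

lemma isBestResponse_waterfill (hν : 0 < ν) (hg : IsGain μ g)
    (hc : ∫ ω, waterfill ν (g ω) ∂μ = c) :
    IsBestResponse μ c g fun ω => waterfill ν (g ω) :=
  ⟨isPolicy_waterfill hg hc, fun _ hQ => logValue_le_logValue_waterfill hν hg hc hQ⟩

end optimality

section waterLevel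

variable [IsFiniteMeasure μ]

lemma exists_le_setIntegral_waterfill (hg : IsGain μ g) {A : Set Ω} (hA : MeasurableSet A)
    (hμA : μ A ≠ 0) (c : ℝ) : ∃ ν, c ≤ ∫ ω in A, waterfill ν (g ω) ∂μ := by
  obtain ⟨k, hk⟩ := exists_nat_measure_inter_le_ne_zero hμA fun ω => (g ω)⁻¹
  set B := A ∩ {ω | (g ω)⁻¹ ≤ k}
  have hB : MeasurableSet B := hA.inter (measurableSet_le hg.measurable.inv measurable_const)
  have hμB : 0 < μ.real B := ENNReal.toReal_pos hk (measure_ne_top _ _)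
  set ν := c / μ.real B + k
  have hi := (integrable_waterfill ν hg).integrableOn (s := A)
  refine ⟨ν, ?_⟩
  calc c = ∫ _ω in B, c / μ.real B ∂μ := by
        rw [setIntegral_const, smul_eq_mul, mul_div_cancel₀ _ hμB.ne']
    _ ≤ ∫ ω in B, waterfill ν (g ω) ∂μ :=
        setIntegral_mono_on (integrable_const _) (hi.mono_set Set.inter_subset_left) hB
          fun ω hω => le_max_of_le_left (le_sub_iff_add_le.2 (add_le_add_right hω.2 _))
    _ ≤ ∫ ω in A, waterfill ν (g ω) ∂μ :=
        setIntegral_mono_set hi (.of_forall fun _ => waterfill_nonneg _ _)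
          Set.inter_subset_left.eventuallyLE

lemma exists_le_integral_waterfill [NeZero μ] (hg : IsGain μ g) (c : ℝ) :
    ∃ ν, c ≤ ∫ ω, waterfill ν (g ω) ∂μ := by
  simpa using exists_le_setIntegral_waterfill hg MeasurableSet.univ
    (Measure.measure_univ_ne_zero.2 (NeZero.ne μ)) c

lemma continuous_integral_waterfill {T : Type*} [TopologicalSpace T] [FirstCountableTopology T]
    {ν : T → ℝ} {g : T → Ω → ℝ} (hν : Continuous ν) (hg : ∀ t, IsGain μ (g t))
    (hcont : ∀ᵐ ω ∂μ, Continuous fun t => waterfill (ν t) (g t ω)) :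
    Continuous fun t => ∫ ω, waterfill (ν t) (g t ω) ∂μ := by
  refine continuous_iff_continuousAt.2 fun t₀ => ?_
  refine continuousAt_of_dominated (bound := fun _ => |ν t₀| + 1)
    (.of_forall fun t => (integrable_waterfill (ν t) (hg t)).aestronglyMeasurable) ?_
    (integrable_const _) (hcont.mono fun ω hω => hω.continuousAt)
  filter_upwards [hν.abs.continuousAt.eventually_lt_const (lt_add_one |ν t₀|)] with t ht
  exact .of_forall fun ω => (abs_waterfill_le ((hg t).nonneg ω)).trans ht.le

lemma exists_integral_waterfill_eq [NeZero μ] (hg : IsGain μ g) (hc : 0 < c) :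
    ∃ ν, 0 < ν ∧ ∫ ω, waterfill ν (g ω) ∂μ = c := by
  obtain ⟨ν₁, h₁⟩ := exists_le_integral_waterfill hg c
  have h₀ : ∫ ω, waterfill 0 (g ω) ∂μ = 0 := integral_waterfill_of_nonpos hg.nonneg le_rfl
  have hcont : Continuous fun ν => ∫ ω, waterfill ν (g ω) ∂μ :=
    continuous_integral_waterfill continuous_id (fun _ => hg)
      (.of_forall fun ω => by unfold waterfill; fun_prop)
  obtain ⟨ν, hν⟩ := mem_range_of_exists_le_of_exists_ge hcont ⟨0, h₀.trans_le hc.le⟩ ⟨ν₁, h₁⟩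
  refine ⟨ν, not_le.1 fun hle => hc.ne ?_, hν⟩
  exact (integral_waterfill_of_nonpos hg.nonneg hle).symm.trans hν

namespace IsBestResponse

variable [NeZero μ]

lemma exists_eq_waterfill (hg : IsGain μ g) (hc : 0 < c) (hP : IsBestResponse μ c g P) :
    ∃ ν, 0 < ν ∧ ∫ ω, waterfill ν (g ω) ∂μ = c ∧ P =ᵐ[μ] fun ω => waterfill ν (g ω) := by
  obtain ⟨ν, hν, h⟩ := exists_integral_waterfill_eq hg hc
  exact ⟨ν, hν, h, ae_eq_waterfill_of_logValue_le hν hg h hP.isPolicy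
    (hP.le _ (isPolicy_waterfill hg h))⟩

lemma ae_eq_of_logValue_le (hg : IsGain μ g) (hc : 0 < c) (hP : IsBestResponse μ c g P)
    (hQ : IsPolicy μ c Q) (h : logValue μ g P ≤ logValue μ g Q) : Q =ᵐ[μ] P := by
  obtain ⟨ν, hν, hi, hPν⟩ := hP.exists_eq_waterfill hg hc
  rw [logValue_congr (ae_eq_refl g) hPν] at h
  exact (ae_eq_waterfill_of_logValue_le hν hg hi hQ h).trans hPν.symm

end IsBestResponse

end waterLevel

end singleUser

/-! ### The equilibrium of least interference -/

lemma isLeast_of_isGLB_of_infClosed {α : Type*} [SemilatticeInf α] [TopologicalSpace α]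
    [InfConvergenceClass α] {S : Set α} {z : α} (hS : IsClosed S) (hinf : InfClosed S)
    (hne : S.Nonempty) (hz : IsGLB S z) : IsLeast S z := by
  have : Nonempty S := hne.to_subtype
  have : IsCodirectedOrder S :=
    ⟨fun a b => ⟨⟨a ⊓ b, hinf a.2 b.2⟩, inf_le_left (a := a.1), inf_le_right (a := a.1)⟩⟩
  have htendsto : Filter.Tendsto ((↑) : S → α) Filter.atBot (nhds z) :=
    tendsto_atBot_isGLB (Subtype.mono_coe _) (by rwa [Subtype.range_coe])
  exact ⟨hS.mem_of_tendsto htendsto (.of_forall Subtype.property), hz.1⟩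

lemma exists_isLeast_of_infClosed {S : Set (ℝ × ℝ)} (hS : IsClosed S) (hinf : InfClosed S)
    (hne : S.Nonempty) (hbdd : BddBelow S) : ∃ z, IsLeast S z := by
  obtain ⟨x, hx⟩ := Real.exists_isGLB (hne.image _) (monotone_fst.map_bddBelow hbdd)
  obtain ⟨y, hy⟩ := Real.exists_isGLB (hne.image _) (monotone_snd.map_bddBelow hbdd)
  exact ⟨(x, y), isLeast_of_isGLB_of_infClosed hS hinf hne (isGLB_prod.2 ⟨hx, hy⟩)⟩

section superlevel

variable {F G : ℝ × ℝ → ℝ} {c₁ c₂ : ℝ}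

lemma infClosed_superlevel (hFy : ∀ x, Antitone fun y => F (x, y))
    (hGx : ∀ y, Antitone fun x => G (x, y)) : InfClosed {z | c₁ ≤ F z ∧ c₂ ≤ G z} := by
  rintro ⟨x, y⟩ ⟨hF, hG⟩ ⟨x', y'⟩ ⟨hF', hG'⟩
  constructor
  · change c₁ ≤ F (x ⊓ x', y ⊓ y')
    rcases min_choice x x' with h | h <;> rw [h]
    · exact hF.trans (hFy x inf_le_left)
    · exact hF'.trans (hFy x' inf_le_right)
  · change c₂ ≤ G (x ⊓ x', y ⊓ y')
    rcases min_choice y y' with h | h <;> rw [h]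
    · exact hG.trans (hGx y inf_le_left)
    · exact hG'.trans (hGx y' inf_le_right)

/-- If one of the inequalities were strict at the least point, its own coordinate could be lowered:
this keeps the other inequality, by antitonicity. -/
lemma exists_isLeast_superlevel_eq (hF : Continuous F) (hG : Continuous G)
    (hFy : ∀ x, Antitone fun y => F (x, y)) (hGx : ∀ y, Antitone fun x => G (x, y))
    (hne : {z | c₁ ≤ F z ∧ c₂ ≤ G z}.Nonempty) (hbdd : BddBelow {z | c₁ ≤ F z ∧ c₂ ≤ G z}) :
    ∃ z, IsLeast {z | c₁ ≤ F z ∧ c₂ ≤ G z} z ∧ F z = c₁ ∧ G z = c₂ := by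
  obtain ⟨⟨x, y⟩, ⟨hxF, hxG⟩, hleast⟩ := exists_isLeast_of_infClosed
    ((isClosed_le continuous_const hF).inter (isClosed_le continuous_const hG))
    (infClosed_superlevel hFy hGx) hne hbdd
  refine ⟨(x, y), ⟨⟨hxF, hxG⟩, hleast⟩, hxF.antisymm' (not_lt.1 fun hlt => ?_),
    hxG.antisymm' (not_lt.1 fun hlt => ?_)⟩
  · have hcont : Continuous fun t => F (t, y) := by fun_prop
    obtain ⟨t, htx, ht⟩ := (hcont.continuousAt.eventually_const_lt hlt).exists_lt
    exact htx.not_ge (hleast ⟨ht.le, hxG.trans (hGx y htx.le)⟩).1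
  · have hcont : Continuous fun t => G (x, t) := by fun_prop
    obtain ⟨t, hty, ht⟩ := (hcont.continuousAt.eventually_const_lt hlt).exists_lt
    exact hty.not_ge (hleast ⟨hxF.trans (hFy x hty.le), ht.le⟩).2

end superlevel

/-- The effective gain of a user with gain `a` when the other user, with gain `b`, transmits at
power `q`; `d` is the Gram determinant of the two channels. -/
noncomputable def effectiveGain (a b d q : ℝ) : ℝ := (a + q * d) / (1 + q * b)

/-- The determinant of `1 + p h₁ h₁ᵀ + q h₂ h₂ᵀ` when the channels have gains `a`, `b` and Gram
determinant `d`. -/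
def jointDet (a b d p q : ℝ) : ℝ := 1 + p * a + q * b + p * q * d

section effectiveGain

variable {a b d q q' : ℝ}

@[simp]
lemma effectiveGain_zero (a b d : ℝ) : effectiveGain a b d 0 = a := by simp [effectiveGain]

lemma effectiveGain_nonneg (ha : 0 ≤ a) (hb : 0 ≤ b) (hd : 0 ≤ d) (hq : 0 ≤ q) :
    0 ≤ effectiveGain a b d q := by
  unfold effectiveGain; positivity

lemma effectiveGain_pos (ha : 0 < a) (hb : 0 ≤ b) (hd : 0 ≤ d) (hq : 0 ≤ q) :
    0 < effectiveGain a b d q := by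
  unfold effectiveGain; positivity

lemma effectiveGain_antitone (hb : 0 ≤ b) (hd : d ≤ a * b) (hq : 0 ≤ q) (h : q ≤ q') :
    effectiveGain a b d q' ≤ effectiveGain a b d q := by
  have hq' : 0 ≤ q' := hq.trans h
  unfold effectiveGain
  rw [div_le_div_iff₀ (by positivity) (by positivity)]
  linarith [mul_nonneg (sub_nonneg.2 h) (sub_nonneg.2 hd)]

lemma effectiveGain_le (hb : 0 ≤ b) (hd : d ≤ a * b) (hq : 0 ≤ q) : effectiveGain a b d q ≤ a := by
  simpa using effectiveGain_antitone hb hd le_rfl hq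

lemma one_add_mul_one_add_mul_effectiveGain (p : ℝ) (hb : 0 ≤ b) (hq : 0 ≤ q) :
    (1 + q * b) * (1 + p * effectiveGain a b d q) = jointDet a b d p q := by
  unfold effectiveGain jointDet
  field_simp
  ring

end effectiveGain

/-- Two users over a common space of fading states: their power gains, relative to the noise, and
the Gram determinant of their channel vectors. -/
structure GainPair (Ω : Type*) where
  fst : Ω → ℝ
  snd : Ω → ℝ
  gram : Ω → ℝ

namespace GainPair

variable {Ω : Type*}

/-- The same two users with their roles exchanged. Every notion below is stated for user 1; user 2
is covered by passing from `G` and `D` to `G.swap` and `Dᶜ`. -/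
def swap (G : GainPair Ω) : GainPair Ω := ⟨G.snd, G.fst, G.gram⟩

/-- The gain of user 1 when the policy `Q` of user 2 interferes exactly on `D`. -/
noncomputable def interferedGain (G : GainPair Ω) (D : Set Ω) (Q : Ω → ℝ) (ω : Ω) : ℝ :=
  effectiveGain (G.fst ω) (G.snd ω) (G.gram ω) (D.indicator Q ω)

/-- The water-filling policy of user 1 at level `z.1` against interference, exactly on `D`, by
water-filling of user 2 at level `z.2`. Where user 2 interferes, it suffers no interference
itself, hence water-fills over its own gain `G.snd`. -/
noncomputable def levelPolicy (G : GainPair Ω) (D : Set Ω) (z : ℝ × ℝ) (ω : Ω) : ℝ :=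
  waterfill z.1 (G.interferedGain D (fun ω => waterfill z.2 (G.snd ω)) ω)

variable {G : GainPair Ω} {D : Set Ω} {P Q : Ω → ℝ} {ω : Ω}

lemma swap_swap : G.swap.swap = G := rfl

lemma interferedGain_of_mem (hω : ω ∈ D) :
    G.interferedGain D Q ω = effectiveGain (G.fst ω) (G.snd ω) (G.gram ω) (Q ω) := by
  rw [interferedGain, Set.indicator_of_mem hω]

lemma interferedGain_of_notMem (hω : ω ∉ D) : G.interferedGain D Q ω = G.fst ω := by
  rw [interferedGain, Set.indicator_of_notMem hω, effectiveGain_zero]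

lemma interferedGain_empty : G.interferedGain ∅ Q = G.fst :=
  funext fun ω => interferedGain_of_notMem (Set.notMem_empty ω)

lemma levelPolicy_of_notMem {z : ℝ × ℝ} (hω : ω ∉ D) :
    G.levelPolicy D z ω = waterfill z.1 (G.fst ω) := by
  rw [levelPolicy, interferedGain_of_notMem hω]

lemma swap_levelPolicy_of_mem {z : ℝ × ℝ} (hω : ω ∈ D) :
    G.swap.levelPolicy Dᶜ z ω = waterfill z.1 (G.snd ω) :=
  levelPolicy_of_notMem (Set.notMem_compl_iff.2 hω)

lemma continuous_levelPolicy (hfst : 0 < G.fst ω) (hsnd : 0 ≤ G.snd ω) (hgram : 0 ≤ G.gram ω) :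
    Continuous fun z => G.levelPolicy D z ω := by
  have hQ : ∀ z : ℝ × ℝ, 0 ≤ D.indicator (fun ω => waterfill z.2 (G.snd ω)) ω := fun z =>
    Set.indicator_nonneg (fun _ _ => waterfill_nonneg _ _) ω
  have hQc : Continuous fun z : ℝ × ℝ => D.indicator (fun ω => waterfill z.2 (G.snd ω)) ω := by
    by_cases hω : ω ∈ D
    · simp only [Set.indicator_of_mem hω, waterfill]
      fun_prop
    · simp only [Set.indicator_of_notMem hω]
      fun_prop
  have hgain : Continuous fun z : ℝ × ℝ =>
      G.interferedGain D (fun ω => waterfill z.2 (G.snd ω)) ω := by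
    unfold interferedGain effectiveGain
    exact Continuous.div (by fun_prop) (by fun_prop) fun z => by have := hQ z; positivity
  have hinv := hgain.inv₀ fun z => (effectiveGain_pos hfst hsnd hgram (hQ z)).ne'
  exact (continuous_fst.sub hinv).max continuous_const

variable [MeasurableSpace Ω] {μ : Measure Ω}

/-- Both users have admissible gains, and the Gram determinant `‖h₁‖²‖h₂‖² - ⟨h₁, h₂⟩²` lies between
`0` and the product of the gains. -/
structure IsRegular (G : GainPair Ω) (μ : Measure Ω) : Prop where
  isGain_fst : IsGain μ G.fst
  isGain_snd : IsGain μ G.snd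
  measurable_gram : Measurable G.gram
  gram_nonneg : ∀ ω, 0 ≤ G.gram ω
  gram_le : ∀ ω, G.gram ω ≤ G.fst ω * G.snd ω

/-- The payoff of user 1, up to a factor, when user 2 interferes exactly on `D`. -/
noncomputable def payoff (G : GainPair Ω) (μ : Measure Ω) (D : Set Ω) (P Q : Ω → ℝ) : ℝ :=
  logValue μ (G.interferedGain D Q) P

/-- Equilibria of the game in which user 1 suffers interference on `D` and user 2 on `Dᶜ`. -/
structure IsEquilibrium (G : GainPair Ω) (μ : Measure Ω) (c₁ c₂ : ℝ) (D : Set Ω)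
    (P Q : Ω → ℝ) : Prop where
  best_fst : IsBestResponse μ c₁ (G.interferedGain D Q) P
  best_snd : IsBestResponse μ c₂ (G.swap.interferedGain Dᶜ P) Q

lemma IsRegular.swap (h : G.IsRegular μ) : G.swap.IsRegular μ :=
  ⟨h.isGain_snd, h.isGain_fst, h.measurable_gram, h.gram_nonneg,
    fun ω => (h.gram_le ω).trans_eq (mul_comm _ _)⟩

lemma IsEquilibrium.swap {c₁ c₂ : ℝ} (h : G.IsEquilibrium μ c₁ c₂ D P Q) :
    G.swap.IsEquilibrium μ c₂ c₁ Dᶜ Q P :=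
  ⟨h.best_snd, by rw [compl_compl]; exact h.best_fst⟩

lemma IsRegular.isGain_interferedGain (h : G.IsRegular μ) (hD : MeasurableSet D)
    (hm : Measurable Q) (hQ : ∀ ω, 0 ≤ Q ω) : IsGain μ (G.interferedGain D Q) := by
  have hQ' : ∀ ω, 0 ≤ D.indicator Q ω := Set.indicator_nonneg fun ω _ => hQ ω
  have hm' := hm.indicator hD
  have hmeas : Measurable (G.interferedGain D Q) :=
    (h.isGain_fst.measurable.add (hm'.mul h.measurable_gram)).div
      ((hm'.mul h.isGain_snd.measurable).const_add 1)
  have hnonneg : ∀ ω, 0 ≤ G.interferedGain D Q ω := fun ω => effectiveGain_nonneg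
    (h.isGain_fst.nonneg ω) (h.isGain_snd.nonneg ω) (h.gram_nonneg ω) (hQ' ω)
  refine ⟨hmeas, hnonneg, ?_, ?_⟩
  · filter_upwards [h.isGain_fst.pos] with ω hω
    exact effectiveGain_pos hω (h.isGain_snd.nonneg ω) (h.gram_nonneg ω) (hQ' ω)
  · refine h.isGain_fst.integrable_log.mono' (hmeas.const_add 1).log.aestronglyMeasurable
      (.of_forall fun ω => ?_)
    rw [Real.norm_eq_abs, abs_of_nonneg (log_one_add_nonneg (hnonneg ω))]
    exact Real.log_le_log (add_pos_of_pos_of_nonneg one_pos (hnonneg ω)) (add_le_add_right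
      (effectiveGain_le (h.isGain_snd.nonneg ω) (h.gram_le ω) (hQ' ω)) 1)

lemma IsRegular.isGain_interferedGain_waterfill (h : G.IsRegular μ) (hD : MeasurableSet D) (y : ℝ) :
    IsGain μ (G.interferedGain D fun ω => waterfill y (G.snd ω)) :=
  h.isGain_interferedGain hD (measurable_waterfill y h.isGain_snd.measurable)
    fun _ => waterfill_nonneg _ _

lemma interferedGain_congr_ae (h : ∀ᵐ ω ∂μ, ω ∈ D → P ω = Q ω) :
    G.interferedGain D P =ᵐ[μ] G.interferedGain D Q := by
  filter_upwards [h] with ω hω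
  by_cases hωD : ω ∈ D
  · rw [interferedGain_of_mem hωD, interferedGain_of_mem hωD, hω hωD]
  · rw [interferedGain_of_notMem hωD, interferedGain_of_notMem hωD]

lemma IsRegular.interferedGain_antitone (h : G.IsRegular μ) (hP : ∀ ω, 0 ≤ P ω)
    (hPQ : ∀ᵐ ω ∂μ, ω ∈ D → P ω ≤ Q ω) : G.interferedGain D Q ≤ᵐ[μ] G.interferedGain D P := by
  filter_upwards [hPQ] with ω hω
  exact effectiveGain_antitone (h.isGain_snd.nonneg ω) (h.gram_le ω)
    (Set.indicator_nonneg (fun ω _ => hP ω) ω) (Set.indicator_rel_indicator le_rfl hω)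

lemma IsRegular.payoff_nonneg (h : G.IsRegular μ) (hP : ∀ ω, 0 ≤ P ω) (hQ : ∀ ω, 0 ≤ Q ω) :
    0 ≤ G.payoff μ D P Q :=
  logValue_nonneg (fun ω => effectiveGain_nonneg (h.isGain_fst.nonneg ω) (h.isGain_snd.nonneg ω)
    (h.gram_nonneg ω) (Set.indicator_nonneg (fun ω _ => hQ ω) ω)) hP

lemma IsRegular.payoff_le_logValue (h : G.IsRegular μ) (hD : MeasurableSet D) {c : ℝ}
    (hP : IsPolicy μ c P) (hm : Measurable Q) (hQ : ∀ ω, 0 ≤ Q ω) :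
    G.payoff μ D P Q ≤ logValue μ G.fst P := by
  refine logValue_mono_gain (h.isGain_interferedGain hD hm hQ) h.isGain_fst ?_ hP
  exact .of_forall fun ω => effectiveGain_le (h.isGain_snd.nonneg ω) (h.gram_le ω)
    (Set.indicator_nonneg (fun ω _ => hQ ω) ω)

lemma IsRegular.pos_of_integral_levelPolicy_pos (h : G.IsRegular μ) (hD : MeasurableSet D)
    {z : ℝ × ℝ} (hz : 0 < ∫ ω, G.levelPolicy D z ω ∂μ) : 0 < z.1 := by
  by_contra! hle
  exact hz.ne' (integral_waterfill_of_nonpos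
    (h.isGain_interferedGain_waterfill hD z.2).nonneg hle)

lemma IsEquilibrium.isGain {c₁ c₂ : ℝ} (hE : G.IsEquilibrium μ c₁ c₂ D P Q)
    (h : G.IsRegular μ) (hD : MeasurableSet D) :
    IsGain μ (G.interferedGain D Q) :=
  h.isGain_interferedGain hD hE.best_snd.isPolicy.measurable hE.best_snd.isPolicy.nonneg

lemma IsEquilibrium.payoff_le_of_interference_le {P' Q' : Ω → ℝ} {c₁ c₂ : ℝ}
    (hE : G.IsEquilibrium μ c₁ c₂ D P Q)
    (hE' : G.IsEquilibrium μ c₁ c₂ D P' Q') (h : G.IsRegular μ) (hD : MeasurableSet D)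
    (hle : ∀ᵐ ω ∂μ, ω ∈ D → Q ω ≤ Q' ω) : G.payoff μ D P' Q' ≤ G.payoff μ D P Q :=
  (logValue_mono_gain (hE'.isGain h hD) (hE.isGain h hD)
    (h.interferedGain_antitone hE.best_snd.isPolicy.nonneg hle) hE'.best_fst.isPolicy).trans
    (hE.best_fst.le _ hE'.best_fst.isPolicy)

section levels

variable [IsFiniteMeasure μ] {c₁ c₂ : ℝ}

lemma IsRegular.integrable_levelPolicy (h : G.IsRegular μ) (hD : MeasurableSet D) (z : ℝ × ℝ) :
    Integrable (G.levelPolicy D z) μ :=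
  integrable_waterfill z.1 (h.isGain_interferedGain_waterfill hD z.2)

lemma IsRegular.antitone_integral_levelPolicy (h : G.IsRegular μ) (hD : MeasurableSet D) (x : ℝ) :
    Antitone fun y => ∫ ω, G.levelPolicy D (x, y) ω ∂μ := by
  intro y y' hy
  refine integral_mono_ae (h.integrable_levelPolicy hD _) (h.integrable_levelPolicy hD _) ?_
  filter_upwards [(h.isGain_interferedGain_waterfill hD y').pos,
    h.interferedGain_antitone (D := D) (fun ω => waterfill_nonneg y (G.snd ω))
      (.of_forall fun ω _ => waterfill_mono_level hy (G.snd ω))] with ω hpos hle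
  exact waterfill_mono_gain x hpos hle

lemma IsRegular.continuous_integral_levelPolicy (h : G.IsRegular μ) (hD : MeasurableSet D) :
    Continuous fun z => ∫ ω, G.levelPolicy D z ω ∂μ := by
  refine continuous_integral_waterfill continuous_fst
    (fun z => h.isGain_interferedGain_waterfill hD z.2) ?_
  filter_upwards [h.isGain_fst.pos] with ω hω
  exact continuous_levelPolicy hω (h.isGain_snd.nonneg ω) (h.gram_nonneg ω)

/-- User 2 can spend `c₂` on `D`, where it does not suffer interference; user 1 then meets a fixed
gain and can spend `c₁`. -/
lemma IsRegular.exists_le_integral_levelPolicy [NeZero μ] (h : G.IsRegular μ)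
    (hD : MeasurableSet D) (c₁ c₂ : ℝ) (hμ : μ D ≠ 0) :
    ∃ z, c₁ ≤ ∫ ω, G.levelPolicy D z ω ∂μ ∧ c₂ ≤ ∫ ω, G.swap.levelPolicy Dᶜ z.swap ω ∂μ := by
  obtain ⟨y, hy⟩ := exists_le_setIntegral_waterfill h.isGain_snd hD hμ c₂
  obtain ⟨x, hx⟩ := exists_le_integral_waterfill (h.isGain_interferedGain_waterfill hD y) c₁
  refine ⟨(x, y), hx, hy.trans ?_⟩
  calc ∫ ω in D, waterfill y (G.snd ω) ∂μ
      = ∫ ω in D, G.swap.levelPolicy Dᶜ (y, x) ω ∂μ :=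
        setIntegral_congr_fun hD fun ω hω =>
          (swap_levelPolicy_of_mem (G := G) (z := (y, x)) hω).symm
    _ ≤ ∫ ω, G.swap.levelPolicy Dᶜ (y, x) ω ∂μ :=
        setIntegral_le_integral (h.swap.integrable_levelPolicy hD.compl _)
          (.of_forall fun _ => waterfill_nonneg _ _)

lemma IsRegular.nonempty_levels [NeZero μ] (h : G.IsRegular μ) (hD : MeasurableSet D)
    (c₁ c₂ : ℝ) : {z | c₁ ≤ ∫ ω, G.levelPolicy D z ω ∂μ ∧
      c₂ ≤ ∫ ω, G.swap.levelPolicy Dᶜ z.swap ω ∂μ}.Nonempty := by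
  by_cases hμ : μ D = 0
  · have hμ' : μ Dᶜ ≠ 0 := fun h0 => NeZero.ne μ <| Measure.measure_univ_eq_zero.1 <| by
      simpa only [hμ, h0, add_zero, nonpos_iff_eq_zero] using measure_univ_le_add_compl (μ := μ) D
    obtain ⟨z, hz₂, hz₁⟩ := h.swap.exists_le_integral_levelPolicy hD.compl c₂ c₁ hμ'
    rw [compl_compl] at hz₁
    exact ⟨z.swap, hz₁, hz₂⟩
  · exact h.exists_le_integral_levelPolicy hD c₁ c₂ hμ

lemma IsRegular.exists_least_levels [NeZero μ] (h : G.IsRegular μ) (hD : MeasurableSet D)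
    (hc₁ : 0 < c₁) (hc₂ : 0 < c₂) :
    ∃ z, ∫ ω, G.levelPolicy D z ω ∂μ = c₁ ∧ ∫ ω, G.swap.levelPolicy Dᶜ z.swap ω ∂μ = c₂ ∧
      ∀ w, ∫ ω, G.levelPolicy D w ω ∂μ = c₁ →
        ∫ ω, G.swap.levelPolicy Dᶜ w.swap ω ∂μ = c₂ → z ≤ w := by
  obtain ⟨z, ⟨-, hleast⟩, hz₁, hz₂⟩ := exists_isLeast_superlevel_eq
    (h.continuous_integral_levelPolicy hD)
    ((h.swap.continuous_integral_levelPolicy hD.compl).comp continuous_swap)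
    (h.antitone_integral_levelPolicy hD) (h.swap.antitone_integral_levelPolicy hD.compl)
    (h.nonempty_levels hD c₁ c₂)
    ⟨0, fun z hz => ⟨(h.pos_of_integral_levelPolicy_pos hD (hc₁.trans_le hz.1)).le,
      (h.swap.pos_of_integral_levelPolicy_pos hD.compl (hc₂.trans_le hz.2)).le⟩⟩
  exact ⟨z, hz₁, hz₂, fun w hw₁ hw₂ => hleast ⟨hw₁.ge, hw₂.ge⟩⟩

lemma isBestResponse_levelPolicy (h : G.IsRegular μ) (hD : MeasurableSet D) (hc : 0 < c₁)
    {z : ℝ × ℝ} (hz : ∫ ω, G.levelPolicy D z ω ∂μ = c₁) :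
    IsBestResponse μ c₁ (G.interferedGain D (G.swap.levelPolicy Dᶜ z.swap))
      (G.levelPolicy D z) := by
  refine (isBestResponse_waterfill (h.pos_of_integral_levelPolicy_pos hD (hc.trans_eq hz.symm))
    (h.isGain_interferedGain_waterfill hD z.2) hz).congr_gain (interferedGain_congr_ae ?_)
  exact .of_forall fun ω hω =>
    (swap_levelPolicy_of_mem (G := G) (z := z.swap) hω).symm

lemma isEquilibrium_levelPolicy (h : G.IsRegular μ) (hD : MeasurableSet D) (hc₁ : 0 < c₁)
    (hc₂ : 0 < c₂) {z : ℝ × ℝ} (hz₁ : ∫ ω, G.levelPolicy D z ω ∂μ = c₁)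
    (hz₂ : ∫ ω, G.swap.levelPolicy Dᶜ z.swap ω ∂μ = c₂) :
    G.IsEquilibrium μ c₁ c₂ D (G.levelPolicy D z) (G.swap.levelPolicy Dᶜ z.swap) := by
  refine ⟨isBestResponse_levelPolicy h hD hc₁ hz₁, ?_⟩
  have hbest := isBestResponse_levelPolicy h.swap hD.compl hc₂ hz₂
  rwa [compl_compl, Prod.swap_swap, swap_swap] at hbest

namespace IsEquilibrium

variable {P' Q' : Ω → ℝ}

lemma exists_levels [NeZero μ] (hE : G.IsEquilibrium μ c₁ c₂ D P Q) (h : G.IsRegular μ)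
    (hD : MeasurableSet D) (hc₁ : 0 < c₁) (hc₂ : 0 < c₂) :
    ∃ z : ℝ × ℝ, ∫ ω, G.levelPolicy D z ω ∂μ = c₁ ∧
      ∫ ω, G.swap.levelPolicy Dᶜ z.swap ω ∂μ = c₂ ∧
      P =ᵐ[μ] G.levelPolicy D z ∧ Q =ᵐ[μ] G.swap.levelPolicy Dᶜ z.swap := by
  obtain ⟨x, -, hix, hPx⟩ := hE.best_fst.exists_eq_waterfill (hE.isGain h hD) hc₁
  obtain ⟨y, -, hiy, hQy⟩ :=
    hE.best_snd.exists_eq_waterfill (hE.swap.isGain h.swap hD.compl) hc₂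
  have hgain₁ : G.interferedGain D Q =ᵐ[μ]
      G.interferedGain D fun ω => waterfill y (G.snd ω) := by
    refine interferedGain_congr_ae ?_
    filter_upwards [hQy] with ω hω hωD
    rw [hω, interferedGain_of_notMem (Set.notMem_compl_iff.2 hωD), GainPair.swap]
  have hgain₂ : G.swap.interferedGain Dᶜ P =ᵐ[μ]
      G.swap.interferedGain Dᶜ fun ω => waterfill x (G.fst ω) := by
    refine interferedGain_congr_ae ?_
    filter_upwards [hPx] with ω hω hωD
    rw [hω, interferedGain_of_notMem hωD]
  have hP : P =ᵐ[μ] G.levelPolicy D (x, y) := hPx.trans (hgain₁.fun_comp (waterfill x))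
  have hQ : Q =ᵐ[μ] G.swap.levelPolicy Dᶜ (y, x) := hQy.trans (hgain₂.fun_comp (waterfill y))
  exact ⟨(x, y), (integral_congr_ae (hP.symm.trans hPx)).trans hix,
    (integral_congr_ae (hQ.symm.trans hQy)).trans hiy, hP, hQ⟩

lemma ae_eq_of_interference_le [NeZero μ] (hE : G.IsEquilibrium μ c₁ c₂ D P Q)
    (hE' : G.IsEquilibrium μ c₁ c₂ D P' Q') (h : G.IsRegular μ) (hD : MeasurableSet D)
    (hc₁ : 0 < c₁) (hle : ∀ᵐ ω ∂μ, ω ∈ D → Q ω ≤ Q' ω)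
    (hpayoff : G.payoff μ D P Q ≤ G.payoff μ D P' Q') : P' =ᵐ[μ] P :=
  hE.best_fst.ae_eq_of_logValue_le (hE.isGain h hD) hc₁ hE'.best_fst.isPolicy <|
    hpayoff.trans <| logValue_mono_gain (hE'.isGain h hD) (hE.isGain h hD)
      (h.interferedGain_antitone hE.best_snd.isPolicy.nonneg hle) hE'.best_fst.isPolicy

end IsEquilibrium

theorem exists_isEquilibrium_least_interference [NeZero μ] (h : G.IsRegular μ)
    (hD : MeasurableSet D) (hc₁ : 0 < c₁) (hc₂ : 0 < c₂) :
    ∃ P Q, G.IsEquilibrium μ c₁ c₂ D P Q ∧ ∀ P' Q', G.IsEquilibrium μ c₁ c₂ D P' Q' →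
      (∀ᵐ ω ∂μ, ω ∈ D → Q ω ≤ Q' ω) ∧ ∀ᵐ ω ∂μ, ω ∈ Dᶜ → P ω ≤ P' ω := by
  obtain ⟨z, hz₁, hz₂, hleast⟩ := h.exists_least_levels hD hc₁ hc₂
  refine ⟨_, _, isEquilibrium_levelPolicy h hD hc₁ hc₂ hz₁ hz₂, fun P' Q' hE => ?_⟩
  obtain ⟨w, hw₁, hw₂, hP', hQ'⟩ := hE.exists_levels h hD hc₁ hc₂
  have hzw := hleast w hw₁ hw₂
  constructor
  · filter_upwards [hQ'] with ω hω hωD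
    rw [hω, swap_levelPolicy_of_mem hωD, swap_levelPolicy_of_mem hωD]
    exact waterfill_mono_level hzw.2 _
  · filter_upwards [hP'] with ω hω hωD
    rw [hω, levelPolicy_of_notMem hωD, levelPolicy_of_notMem hωD]
    exact waterfill_mono_level hzw.1 _

lemma exists_isEquilibrium_dominating [NeZero μ] (h : G.IsRegular μ) (hD : MeasurableSet D)
    (hc₁ : 0 < c₁) (hc₂ : 0 < c₂) :
    ∃ P Q, G.IsEquilibrium μ c₁ c₂ D P Q ∧ ∀ P' Q', G.IsEquilibrium μ c₁ c₂ D P' Q' →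
      (G.payoff μ D P' Q' ≤ G.payoff μ D P Q ∧
        G.swap.payoff μ Dᶜ Q' P' ≤ G.swap.payoff μ Dᶜ Q P) ∧
      (G.payoff μ D P Q ≤ G.payoff μ D P' Q' → P' =ᵐ[μ] P) ∧
      (G.swap.payoff μ Dᶜ Q P ≤ G.swap.payoff μ Dᶜ Q' P' → Q' =ᵐ[μ] Q) := by
  obtain ⟨P, Q, hE, hleast⟩ := exists_isEquilibrium_least_interference h hD hc₁ hc₂
  refine ⟨P, Q, hE, fun P' Q' hE' => ?_⟩
  obtain ⟨hQ, hP⟩ := hleast P' Q' hE'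
  exact ⟨⟨hE.payoff_le_of_interference_le hE' h hD hQ,
    hE.swap.payoff_le_of_interference_le hE'.swap h.swap hD.compl hP⟩,
    hE.ae_eq_of_interference_le hE' h hD hc₁ hQ,
    hE.swap.ae_eq_of_interference_le hE'.swap h.swap hD.compl hc₂ hP⟩

end levels

end GainPair

/-! ### Compactness of midpoint-convex families of policies -/

open Filter Topology

/-- Choose `z k` almost minimizing `Φ` over `K k`. The minima increase to a limit `s`, and the
midpoint of `z k` and `z N` lies in `K N`, so that `Φ` is close to `s` at all three points. -/
lemma exists_seq_mem_midpoint_gap_lt {E : Type*} [AddCommGroup E] [Module ℝ E] {K : ℕ → Set E}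
    (hK : Antitone K) (hne : ∀ k, (K k).Nonempty)
    (hmid : ∀ k, ∀ z ∈ K k, ∀ w ∈ K k, midpoint ℝ z w ∈ K k) {Φ : E → ℝ}
    (hbelow : BddBelow (Φ '' K 0)) (habove : BddAbove (Φ '' K 0)) :
    ∃ z : ℕ → E, (∀ k, z k ∈ K k) ∧ ∀ ε > 0, ∃ N, ∀ k ≥ N,
      Φ (z k) + Φ (z N) - 2 * Φ (midpoint ℝ (z k) (z N)) < ε := by
  set m : ℕ → ℝ := fun k => sInf (Φ '' K k)
  have hbelow' : ∀ k, BddBelow (Φ '' K k) := fun k =>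
    hbelow.mono (Set.image_mono (hK (Nat.zero_le k)))
  have hm_le : ∀ k, ∀ z ∈ K k, m k ≤ Φ z := fun k z hz => csInf_le (hbelow' k) ⟨z, hz, rfl⟩
  have hm_mono : Monotone m := fun j k hjk =>
    csInf_le_csInf (hbelow' j) ((hne k).image Φ) (Set.image_mono (hK hjk))
  have hm_bdd : BddAbove (Set.range m) := by
    refine habove.imp fun B hB => ?_
    rintro _ ⟨k, rfl⟩
    obtain ⟨z, hz⟩ := hne k
    exact (hm_le k z hz).trans (hB ⟨z, hK (Nat.zero_le k) hz, rfl⟩)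
  have hz : ∀ k : ℕ, ∃ z ∈ K k, Φ z < m k + 1 / ((k : ℝ) + 1) := fun k => by
    obtain ⟨_, ⟨z, hz, rfl⟩, hlt⟩ := exists_lt_of_csInf_lt ((hne k).image Φ)
      (lt_add_of_pos_right (m k) (Nat.one_div_pos_of_nat (n := k)))
    exact ⟨z, hz, hlt⟩
  choose z hzK hzΦ using hz
  refine ⟨z, hzK, fun ε hε => ?_⟩
  have hlim : Tendsto (fun k : ℕ => m k - 1 / ((k : ℝ) + 1)) atTop (𝓝 (⨆ k, m k)) := by
    simpa only [sub_zero] using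
      (tendsto_atTop_ciSup hm_mono hm_bdd).sub tendsto_one_div_add_atTop_nhds_zero_nat
  obtain ⟨N, hN⟩ := (hlim.eventually_const_lt
    (show (⨆ k, m k) - ε / 2 < ⨆ k, m k by linarith)).exists
  refine ⟨N, fun k hk => ?_⟩
  have hmidpoint := hm_le N _ (hmid N _ (hK hk (hzK k)) _ (hzK N))
  have hδ : 1 / ((k : ℝ) + 1) ≤ 1 / ((N : ℝ) + 1) := Nat.one_div_le_one_div hk
  linarith [hzΦ k, hzΦ N, le_ciSup hm_bdd k, le_ciSup hm_bdd N]

section policies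

variable {Ω : Type*}

lemma midpoint_apply (P Q : Ω → ℝ) (ω : Ω) : midpoint ℝ P Q ω = (P ω + Q ω) / 2 := by
  rw [midpoint_eq_smul_add, Pi.smul_apply, Pi.add_apply, smul_eq_mul, invOf_eq_inv, inv_mul_eq_div]

lemma midpoint_mk_mk (z w : (Ω → ℝ) × (Ω → ℝ)) :
    midpoint ℝ z w = (midpoint ℝ z.1 w.1, midpoint ℝ z.2 w.2) := by
  simp only [midpoint_eq_smul_add, Prod.ext_iff, Prod.smul_fst, Prod.smul_snd, Prod.fst_add,
    Prod.snd_add, and_self]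

variable [MeasurableSpace Ω] {μ : Measure Ω} {c c₁ c₂ : ℝ} {P Q : Ω → ℝ}

lemma IsPolicy.midpoint (hP : IsPolicy μ c P) (hQ : IsPolicy μ c Q) :
    IsPolicy μ c (midpoint ℝ P Q) := by
  rw [show _root_.midpoint ℝ P Q = fun ω => (P ω + Q ω) / 2 from funext (midpoint_apply P Q)]
  refine ⟨(hP.measurable.add hQ.measurable).div_const 2,
    fun ω => by linarith [hP.nonneg ω, hQ.nonneg ω],
    (hP.integrable.add hQ.integrable).div_const 2, ?_⟩
  rw [integral_div, integral_add hP.integrable hQ.integrable]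
  linarith [hP.average_le, hQ.average_le]

lemma integrable_and_integral_le_of_tendsto {f : ℕ → Ω → ℝ} {g : Ω → ℝ} {c : ℕ → ℝ} {l : ℝ}
    (hf : ∀ k, Integrable (f k) μ) (hf_nonneg : ∀ k ω, 0 ≤ f k ω)
    (hfg : ∀ᵐ ω ∂μ, Tendsto (fun k => f k ω) atTop (𝓝 (g ω)))
    (hc : ∀ k, ∫ ω, f k ω ∂μ ≤ c k) (hcl : Tendsto c atTop (𝓝 l)) :
    Integrable g μ ∧ ∫ ω, g ω ∂μ ≤ l := by
  have hg_nonneg : 0 ≤ᵐ[μ] g := by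
    filter_upwards [hfg] with ω hω
    exact ge_of_tendsto' hω fun k => hf_nonneg k ω
  have hl : 0 ≤ l := ge_of_tendsto' hcl fun k => (integral_nonneg (hf_nonneg k)).trans (hc k)
  have hfatou : ∫⁻ ω, ENNReal.ofReal (g ω) ∂μ ≤ ENNReal.ofReal l := by
    calc ∫⁻ ω, ENNReal.ofReal (g ω) ∂μ
        = ∫⁻ ω, liminf (fun k => ENNReal.ofReal (f k ω)) atTop ∂μ := by
          refine lintegral_congr_ae ?_
          filter_upwards [hfg] with ω hω
          exact (ENNReal.tendsto_ofReal hω).liminf_eq.symm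
      _ ≤ liminf (fun k => ∫⁻ ω, ENNReal.ofReal (f k ω) ∂μ) atTop :=
          lintegral_liminf_le' fun k => (hf k).aemeasurable.ennreal_ofReal
      _ ≤ liminf (fun k => ENNReal.ofReal (c k)) atTop := by
          refine liminf_le_liminf (.of_forall fun k => ?_)
          rw [← ofReal_integral_eq_lintegral_ofReal (hf k) (.of_forall (hf_nonneg k))]
          exact ENNReal.ofReal_le_ofReal (hc k)
      _ = ENNReal.ofReal l := (ENNReal.tendsto_ofReal hcl).liminf_eq
  have hmeas : AEStronglyMeasurable g μ :=
    aestronglyMeasurable_of_tendsto_ae atTop (fun k => (hf k).1) hfg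
  have hg : Integrable g μ :=
    ⟨hmeas, (hasFiniteIntegral_iff_ofReal hg_nonneg).2 (hfatou.trans_lt ENNReal.ofReal_lt_top)⟩
  rw [← ofReal_integral_eq_lintegral_ofReal hg hg_nonneg] at hfatou
  exact ⟨hg, (ENNReal.ofReal_le_ofReal_iff hl).1 hfatou⟩

/-- Fatou's lemma for the nonnegative functions `L + g k - f k`. -/
lemma le_integral_add_of_tendsto {f g : ℕ → Ω → ℝ} {F G L : Ω → ℝ} {s : ℕ → ℝ} {C M : ℝ}
    (hf : ∀ k, Integrable (f k) μ) (hg : ∀ k, Integrable (g k) μ) (hF : Integrable F μ)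
    (hG : Integrable G μ) (hL : Integrable L μ) (hle : ∀ k ω, f k ω ≤ L ω + g k ω)
    (hfF : ∀ᵐ ω ∂μ, Tendsto (fun k => f k ω) atTop (𝓝 (F ω)))
    (hgG : ∀ᵐ ω ∂μ, Tendsto (fun k => g k ω) atTop (𝓝 (G ω))) (hG_nonneg : 0 ≤ᵐ[μ] G)
    (hC : ∀ k, ∫ ω, g k ω ∂μ ≤ C) (hs : ∀ k, s k ≤ ∫ ω, f k ω ∂μ)
    (hsM : Tendsto s atTop (𝓝 M)) : M ≤ ∫ ω, F ω ∂μ + C := by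
  have hint : ∀ {f g : Ω → ℝ}, Integrable f μ → Integrable g μ →
      ∫ ω, (L ω + g ω - f ω) ∂μ = ∫ ω, L ω ∂μ + ∫ ω, g ω ∂μ - ∫ ω, f ω ∂μ := fun {f g} hf hg => by
    have hLg : Integrable (fun ω => L ω + g ω) μ := hL.add hg
    rw [integral_sub hLg hf, integral_add hL hg]
  have hfatou := (integrable_and_integral_le_of_tendsto
    (f := fun k ω => L ω + g k ω - f k ω) (g := fun ω => L ω + G ω - F ω)
    (c := fun k => ∫ ω, L ω ∂μ + C - s k) (fun k => (hL.add (hg k)).sub (hf k))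
    (fun k ω => sub_nonneg.2 (hle k ω))
    (by filter_upwards [hfF, hgG] with ω hFω hGω using (hGω.const_add _).sub hFω)
    (fun k => by rw [hint (hf k) (hg k)]; linarith [hC k, hs k]) (hsM.const_sub _)).2
  rw [hint hF hG] at hfatou
  linarith [integral_nonneg_of_ae hG_nonneg]

lemma dist_toLp_two_sq {f g : Ω → ℝ} (hf : MemLp f 2 μ) (hg : MemLp g 2 μ) :
    dist (hf.toLp f) (hg.toLp g) ^ 2 = ∫ ω, (f ω - g ω) ^ 2 ∂μ := by
  rw [dist_eq_norm, ← MemLp.toLp_sub hf hg, ← real_inner_self_eq_norm_sq, L2.inner_def]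
  refine integral_congr_ae ?_
  filter_upwards [(hf.sub hg).coeFn_toLp] with ω hω
  rw [hω, real_inner_self_eq_norm_sq, Real.norm_eq_abs, sq_abs, Pi.sub_apply]

lemma memLp_exp_neg_div_two [IsFiniteMeasure μ] (hP : Measurable P) (hP_nonneg : ∀ ω, 0 ≤ P ω) :
    MemLp (fun ω => Real.exp (-P ω / 2)) 2 μ := by
  refine MemLp.of_bound (by fun_prop) 1 (.of_forall fun ω => ?_)
  rw [Real.norm_eq_abs, Real.abs_exp, Real.exp_le_one_iff]
  linarith [hP_nonneg ω]

/-- The identity `exp (-p) + exp (-q) - 2 exp (-(p + q) / 2) = (exp (-p / 2) - exp (-q / 2)) ^ 2`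
makes `P ↦ ∫ exp (-P)` uniformly convex. -/
lemma integral_exp_neg_midpoint_gap [IsFiniteMeasure μ] (hP : IsPolicy μ c P)
    (hQ : IsPolicy μ c Q) :
    ∫ ω, Real.exp (-P ω) ∂μ + ∫ ω, Real.exp (-Q ω) ∂μ
        - 2 * ∫ ω, Real.exp (-midpoint ℝ P Q ω) ∂μ =
      ∫ ω, (Real.exp (-P ω / 2) - Real.exp (-Q ω / 2)) ^ 2 ∂μ := by
  have hhalf : ∀ p : ℝ, Real.exp (-p) = Real.exp (-p / 2) ^ 2 := fun p => by
    rw [← Real.exp_nat_mul]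
    congr 1
    push_cast
    ring
  have hint : ∀ {R : Ω → ℝ}, IsPolicy μ c R → Integrable (fun ω => Real.exp (-R ω)) μ :=
    fun hR => by
      simpa only [hhalf] using (memLp_exp_neg_div_two hR.measurable hR.nonneg).integrable_sq
  have hint_add : Integrable (fun ω => Real.exp (-P ω) + Real.exp (-Q ω)) μ :=
    (hint hP).add (hint hQ)
  rw [← integral_add (hint hP) (hint hQ), ← integral_const_mul,
    ← integral_sub hint_add ((hint (hP.midpoint hQ)).const_mul 2)]
  refine integral_congr_ae (.of_forall fun ω => ?_)
  have hprod : Real.exp (-midpoint ℝ P Q ω) = Real.exp (-P ω / 2) * Real.exp (-Q ω / 2) := by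
    rw [← Real.exp_add, midpoint_apply]; congr 1; ring
  simp only [hprod, hhalf (P ω), hhalf (Q ω)]
  ring

/-- By Fatou's lemma, powers with bounded averages cannot escape to infinity. -/
lemma ae_pos_of_tendsto_exp_neg {P : ℕ → Ω → ℝ} (hP : ∀ k, IsPolicy μ c (P k)) {v : Ω → ℝ}
    (hlim : ∀ᵐ ω ∂μ, Tendsto (fun k => Real.exp (-P k ω / 2)) atTop (𝓝 (v ω))) :
    ∀ᵐ ω ∂μ, 0 < v ω := by
  have hbdd : ∀ k, eLpNorm (P k) 1 μ ≤ c.toNNReal := fun k => by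
    rw [eLpNorm_one_eq_lintegral_enorm, ← ofReal_integral_norm_eq_lintegral_enorm (hP k).integrable]
    simp only [Real.norm_eq_abs, abs_of_nonneg ((hP k).nonneg _)]
    exact ENNReal.ofReal_le_ofReal (hP k).average_le
  filter_upwards [hlim, ae_bdd_liminf_atTop_of_eLpNorm_bdd one_ne_zero
    (fun k => (hP k).measurable) hbdd] with ω hω hliminf
  refine (ge_of_tendsto' hω fun k => (Real.exp_pos _).le).lt_of_ne' fun hv => hliminf.ne ?_
  rw [hv, Real.tendsto_exp_comp_nhds_zero] at hω
  have hP_top : Tendsto (fun k => P k ω) atTop atTop := by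
    simpa using (tendsto_neg_atBot_atTop.comp hω).atTop_mul_const two_pos
  refine ((ENNReal.tendsto_ofReal_atTop.comp hP_top).congr fun k => ?_).liminf_eq
  exact (Real.enorm_of_nonneg ((hP k).nonneg ω)).symm

lemma exists_isPolicy_tendsto_of_tendsto_exp_neg {P : ℕ → Ω → ℝ} (hP : ∀ k, IsPolicy μ c (P k))
    {v : Ω → ℝ} (hv : Measurable v)
    (hlim : ∀ᵐ ω ∂μ, Tendsto (fun k => Real.exp (-P k ω / 2)) atTop (𝓝 (v ω))) :
    ∃ Q, IsPolicy μ c Q ∧ ∀ᵐ ω ∂μ, Tendsto (fun k => P k ω) atTop (𝓝 (Q ω)) := by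
  have hlim' : ∀ᵐ ω ∂μ, Tendsto (fun k => P k ω) atTop (𝓝 (max (-(2 * Real.log (v ω))) 0)) := by
    filter_upwards [hlim, ae_pos_of_tendsto_exp_neg hP hlim] with ω hω hpos
    refine (((hω.log hpos.ne').const_mul 2).neg.max tendsto_const_nhds).congr fun k => ?_
    rw [Real.log_exp, mul_div_cancel₀ _ two_ne_zero, neg_neg, max_eq_left ((hP k).nonneg ω)]
  obtain ⟨hint, hle⟩ := integrable_and_integral_le_of_tendsto (fun k => (hP k).integrable)
    (fun k => (hP k).nonneg) hlim' (fun k => (hP k).average_le) tendsto_const_nhds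
  exact ⟨_, ⟨by fun_prop, fun _ => le_max_right _ _, hint, hle⟩, hlim'⟩

lemma exists_subseq_tendsto_ae_of_tendsto_toLp {f : ℕ → Ω → ℝ} (hf : ∀ k, MemLp (f k) 2 μ)
    {V : Lp ℝ 2 μ} (hV : Tendsto (fun k => (hf k).toLp (f k)) atTop (𝓝 V)) :
    ∃ φ : ℕ → ℕ, StrictMono φ ∧ ∀ᵐ ω ∂μ, Tendsto (fun k => f (φ k) ω) atTop (𝓝 (V ω)) := by
  obtain ⟨φ, hφ, hlim⟩ := (tendstoInMeasure_of_tendsto_Lp hV).exists_seq_tendsto_ae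
  refine ⟨φ, hφ, ?_⟩
  filter_upwards [hlim, ae_all_iff.2 fun k => (hf k).coeFn_toLp] with ω hω hcoe
  simpa only [hcoe] using hω

lemma integral_exp_neg_mem_Icc [IsFiniteMeasure μ] (hP : ∀ ω, 0 ≤ P ω) :
    ∫ ω, Real.exp (-P ω) ∂μ ∈ Set.Icc 0 (μ.real Set.univ) := by
  have hle : ∀ ω, Real.exp (-P ω) ≤ 1 := fun ω =>
    Real.exp_le_one_iff.2 (neg_nonpos.2 (hP ω))
  refine ⟨integral_nonneg fun ω => (Real.exp_pos _).le, ?_⟩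
  calc ∫ ω, Real.exp (-P ω) ∂μ ≤ ∫ _, 1 ∂μ :=
        integral_mono_of_nonneg (.of_forall fun ω => (Real.exp_pos _).le) (integrable_const 1)
          (.of_forall hle)
    _ = μ.real Set.univ := by rw [integral_const, smul_eq_mul, mul_one]

section exists_seq

variable [IsFiniteMeasure μ] {K : ℕ → Set ((Ω → ℝ) × (Ω → ℝ))}

lemma exists_seq_mem_cauchySeq_toLp_exp_neg (hK : Antitone K) (hne : ∀ k, (K k).Nonempty)
    (hpol : ∀ z ∈ K 0, IsPolicy μ c₁ z.1 ∧ IsPolicy μ c₂ z.2)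
    (hmid : ∀ k, ∀ z ∈ K k, ∀ w ∈ K k, midpoint ℝ z w ∈ K k) :
    ∃ (z : ℕ → (Ω → ℝ) × (Ω → ℝ)) (hP : ∀ k, MemLp (fun ω => Real.exp (-(z k).1 ω / 2)) 2 μ)
      (hQ : ∀ k, MemLp (fun ω => Real.exp (-(z k).2 ω / 2)) 2 μ), (∀ k, z k ∈ K k) ∧
      CauchySeq fun k => ((hP k).toLp _, (hQ k).toLp _) := by
  have hfst := fun z hz => integral_exp_neg_mem_Icc (μ := μ) (hpol z hz).1.nonneg
  have hsnd := fun z hz => integral_exp_neg_mem_Icc (μ := μ) (hpol z hz).2.nonneg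
  obtain ⟨z, hz, hgap⟩ := exists_seq_mem_midpoint_gap_lt hK hne hmid
    (Φ := fun z => ∫ ω, Real.exp (-z.1 ω) ∂μ + ∫ ω, Real.exp (-z.2 ω) ∂μ)
    ⟨0, Set.forall_mem_image.2 fun z hz => add_nonneg (hfst z hz).1 (hsnd z hz).1⟩
    ⟨_, Set.forall_mem_image.2 fun z hz => add_le_add (hfst z hz).2 (hsnd z hz).2⟩
  have hz_pol := fun k => hpol _ (hK (Nat.zero_le k) (hz k))
  have hP := fun k => memLp_exp_neg_div_two (μ := μ) (hz_pol k).1.measurable (hz_pol k).1.nonneg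
  have hQ := fun k => memLp_exp_neg_div_two (μ := μ) (hz_pol k).2.measurable (hz_pol k).2.nonneg
  refine ⟨z, hP, hQ, hz, Metric.cauchySeq_iff'.2 fun ε hε => ?_⟩
  obtain ⟨N, hN⟩ := hgap (ε ^ 2) (by positivity)
  refine ⟨N, fun k hk => ?_⟩
  have hsum : dist ((hP k).toLp _) ((hP N).toLp _) ^ 2 +
      dist ((hQ k).toLp _) ((hQ N).toLp _) ^ 2 < ε ^ 2 := by
    rw [dist_toLp_two_sq, dist_toLp_two_sq,
      ← integral_exp_neg_midpoint_gap (hz_pol k).1 (hz_pol N).1,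
      ← integral_exp_neg_midpoint_gap (hz_pol k).2 (hz_pol N).2]
    refine (hN k hk).trans_le' (le_of_eq ?_)
    rw [midpoint_mk_mk]
    ring
  refine max_lt (lt_of_pow_lt_pow_left₀ 2 hε.le ?_) (lt_of_pow_lt_pow_left₀ 2 hε.le ?_)
  · exact (le_add_of_nonneg_right (sq_nonneg _)).trans_lt hsum
  · exact (le_add_of_nonneg_left (sq_nonneg _)).trans_lt hsum

/-- A substitute for compactness: sublevel sets of policies are only closed under limits in measure
and midpoints, and a nested sequence of them still has a cluster point. -/
theorem exists_seq_mem_tendsto_ae (hK : Antitone K) (hne : ∀ k, (K k).Nonempty)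
    (hpol : ∀ z ∈ K 0, IsPolicy μ c₁ z.1 ∧ IsPolicy μ c₂ z.2)
    (hmid : ∀ k, ∀ z ∈ K k, ∀ w ∈ K k, midpoint ℝ z w ∈ K k) :
    ∃ (z : ℕ → (Ω → ℝ) × (Ω → ℝ)) (P Q : Ω → ℝ), (∀ k, z k ∈ K k) ∧
      IsPolicy μ c₁ P ∧ IsPolicy μ c₂ Q ∧
      (∀ᵐ ω ∂μ, Tendsto (fun k => (z k).1 ω) atTop (𝓝 (P ω))) ∧
      ∀ᵐ ω ∂μ, Tendsto (fun k => (z k).2 ω) atTop (𝓝 (Q ω)) := by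
  obtain ⟨z, hP, hQ, hz, hcauchy⟩ := exists_seq_mem_cauchySeq_toLp_exp_neg hK hne hpol hmid
  obtain ⟨⟨U, V⟩, hlim⟩ := cauchySeq_tendsto_of_complete hcauchy
  rw [Prod.tendsto_iff] at hlim
  obtain ⟨φ, hφ, hφU⟩ := exists_subseq_tendsto_ae_of_tendsto_toLp hP hlim.1
  obtain ⟨χ, hχ, hχV⟩ := exists_subseq_tendsto_ae_of_tendsto_toLp (fun k => hQ (φ k))
    (hlim.2.comp hφ.tendsto_atTop)
  have hmem : ∀ k, z (φ (χ k)) ∈ K k := fun k => hK ((hφ.comp hχ).id_le k) (hz _)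
  have hz_pol := fun k => hpol _ (hK (Nat.zero_le k) (hmem k))
  obtain ⟨P, hP, hPlim⟩ := exists_isPolicy_tendsto_of_tendsto_exp_neg (fun k => (hz_pol k).1)
    (Lp.stronglyMeasurable U).measurable
    (hφU.mono fun ω hω => hω.comp hχ.tendsto_atTop)
  obtain ⟨Q, hQ, hQlim⟩ := exists_isPolicy_tendsto_of_tendsto_exp_neg (fun k => (hz_pol k).2)
    (Lp.stronglyMeasurable V).measurable hχV
  exact ⟨fun k => z (φ (χ k)), P, Q, hmem, hP, hQ, hPlim, hQlim⟩

end exists_seq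

end policies

/-! ### The sum-rate -/

section jointDet

variable {a b d p q p' q' ε : ℝ}

lemma jointDet_comm : jointDet b a d q p = jointDet a b d p q := by
  unfold jointDet
  ring

lemma one_le_jointDet (ha : 0 ≤ a) (hb : 0 ≤ b) (hd : 0 ≤ d) (hp : 0 ≤ p) (hq : 0 ≤ q) :
    1 ≤ jointDet a b d p q := by
  unfold jointDet
  have : 0 ≤ p * a + q * b + p * q * d := by positivity
  linarith

/-- `B` is the polarization of the quadratic form obtained from `jointDet` by homogenizing. That
form is hyperbolic, so the reversed Cauchy-Schwarz inequality holds; which of the two expressions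
for `B ^ 2 - u * v` exhibits this depends on whether the two users' powers move in the same
direction. -/
lemma jointDet_mul_jointDet_le_sq_polarization (ha : 0 ≤ a) (hb : 0 ≤ b) (hd : 0 ≤ d)
    (hdab : d ≤ a * b) (hp : 0 ≤ p) (hq : 0 ≤ q) :
    jointDet a b d p q * jointDet a b d p' q' ≤
      (1 + (p + p') / 2 * a + (q + q') / 2 * b + (p * q' + p' * q) / 2 * d) ^ 2 := by
  have hu := one_le_jointDet ha hb hd hp hq
  set u := jointDet a b d p q with hu_def
  set v := jointDet a b d p' q' with hv_def
  set B := 1 + (p + p') / 2 * a + (q + q') / 2 * b + (p * q' + p' * q) / 2 * d with hB_def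
  unfold jointDet at hu_def hv_def
  have hopposite : 4 * (B ^ 2 - u * v) = ((p' - p) * (a + q * d) + (q' - q) * (b + p * d)) ^ 2
      - 4 * ((p' - p) * (q' - q)) * (d * u) := by rw [hu_def, hv_def, hB_def]; ring
  have hsame : 4 * (B ^ 2 - u * v) = ((p' - p) * (a + q * d) - (q' - q) * (b + p * d)) ^ 2
      + 4 * ((p' - p) * (q' - q)) * (a * b - d) := by rw [hu_def, hv_def, hB_def]; ring
  rcases le_total 0 ((p' - p) * (q' - q)) with h | h
  · linarith [mul_nonneg h (sub_nonneg.2 hdab),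
      sq_nonneg ((p' - p) * (a + q * d) - (q' - q) * (b + p * d))]
  · linarith [mul_nonneg (neg_nonneg.2 h) (mul_nonneg hd (zero_le_one.trans hu)),
      sq_nonneg ((p' - p) * (a + q * d) + (q' - q) * (b + p * d))]

lemma jointDet_mul_jointDet_le_sq_midpoint (ha : 0 ≤ a) (hb : 0 ≤ b) (hd : 0 ≤ d)
    (hdab : d ≤ a * b) (hp : 0 ≤ p) (hq : 0 ≤ q) (hp' : 0 ≤ p') (hq' : 0 ≤ q') :
    jointDet a b d p q * jointDet a b d p' q' ≤
      jointDet a b d ((p + p') / 2) ((q + q') / 2) ^ 2 := by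
  have hu := one_le_jointDet ha hb hd hp hq
  have hv := one_le_jointDet ha hb hd hp' hq'
  have hle := jointDet_mul_jointDet_le_sq_polarization (p' := p') (q' := q') ha hb hd hdab hp hq
  have hB : 0 ≤ 1 + (p + p') / 2 * a + (q + q') / 2 * b + (p * q' + p' * q) / 2 * d := by
    positivity
  have hmid : jointDet a b d ((p + p') / 2) ((q + q') / 2) =
      (jointDet a b d p q + jointDet a b d p' q' +
        2 * (1 + (p + p') / 2 * a + (q + q') / 2 * b + (p * q' + p' * q) / 2 * d)) / 4 := by
    unfold jointDet
    ring
  rw [hmid]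
  generalize jointDet a b d p q = u at *
  generalize jointDet a b d p' q' = v at *
  generalize 1 + (p + p') / 2 * a + (q + q') / 2 * b + (p * q' + p' * q) / 2 * d = B at *
  have hgeom : √(u * v) ≤ B := Real.sqrt_le_iff.2 ⟨hB, hle⟩
  have harith : √(u * v) ≤ (u + v) / 2 :=
    Real.sqrt_le_iff.2 ⟨by linarith, by linarith [sq_nonneg (u - v)]⟩
  rw [← Real.sqrt_le_left (by linarith)]
  linarith

lemma log_jointDet_eq_add (ha : 0 ≤ a) (hb : 0 ≤ b) (hd : 0 ≤ d) (hp : 0 ≤ p) (hq : 0 ≤ q) :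
    Real.log (jointDet a b d p q) =
      Real.log (1 + p * effectiveGain a b d q) + Real.log (1 + q * b) := by
  have hgain := effectiveGain_nonneg ha hb hd hq
  rw [← one_add_mul_one_add_mul_effectiveGain p hb hq,
    Real.log_mul (by positivity) (by positivity), add_comm]

lemma log_one_add_le_mul_add (hp : 0 ≤ p) (hε : 0 < ε) :
    Real.log (1 + p) ≤ ε * p + (ε - 1 - Real.log ε) := by
  have hlog := Real.log_le_sub_one_of_pos (show 0 < ε * (1 + p) by positivity)
  rw [Real.log_mul hε.ne' (by positivity)] at hlog
  linarith

lemma log_jointDet_le (ha : 0 ≤ a) (hb : 0 ≤ b) (hd : 0 ≤ d) (hdab : d ≤ a * b) (hp : 0 ≤ p)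
    (hq : 0 ≤ q) (hε : 0 < ε) :
    Real.log (jointDet a b d p q) ≤
      Real.log (1 + a) + Real.log (1 + b) + 2 * (ε - 1 - Real.log ε) + ε * (p + q) := by
  have hprod : jointDet a b d p q ≤ (1 + p * a) * (1 + q * b) := by
    unfold jointDet
    linarith [mul_le_mul_of_nonneg_left hdab (mul_nonneg hp hq)]
  have hlog := Real.log_le_log (by linarith [one_le_jointDet ha hb hd hp hq]) hprod
  rw [Real.log_mul (by positivity) (by positivity)] at hlog
  linarith [log_one_add_mul_le hp ha, log_one_add_mul_le hq hb, log_one_add_le_mul_add hp hε,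
    log_one_add_le_mul_add hq hε]

end jointDet

namespace GainPair

variable {Ω : Type*} [MeasurableSpace Ω] {μ : Measure Ω} {G : GainPair Ω} {c₁ c₂ : ℝ}
  {P Q P' Q' : Ω → ℝ}

/-- The joint rate, up to a factor, of the two users. -/
noncomputable def sumLog (G : GainPair Ω) (μ : Measure Ω) (P Q : Ω → ℝ) : ℝ :=
  ∫ ω, Real.log (jointDet (G.fst ω) (G.snd ω) (G.gram ω) (P ω) (Q ω)) ∂μ

/-- `(P, Q)` maximizes the joint rate among the policies with average powers at most `c₁` and
`c₂`. -/
structure IsSumLogMax (G : GainPair Ω) (μ : Measure Ω) (c₁ c₂ : ℝ) (P Q : Ω → ℝ) : Prop where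
  isPolicy_fst : IsPolicy μ c₁ P
  isPolicy_snd : IsPolicy μ c₂ Q
  le : ∀ P' Q', IsPolicy μ c₁ P' → IsPolicy μ c₂ Q' → G.sumLog μ P' Q' ≤ G.sumLog μ P Q

lemma sumLog_swap : G.swap.sumLog μ Q P = G.sumLog μ P Q := by
  simp only [sumLog, swap, jointDet_comm]

lemma sumLog_zero_right : G.sumLog μ P 0 = logValue μ G.fst P := by
  simp [sumLog, logValue, jointDet]

lemma IsSumLogMax.swap (h : G.IsSumLogMax μ c₁ c₂ P Q) : G.swap.IsSumLogMax μ c₂ c₁ Q P :=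
  ⟨h.isPolicy_snd, h.isPolicy_fst, fun Q' P' hQ' hP' => by
    simpa only [sumLog_swap] using h.le P' Q' hP' hQ'⟩

lemma log_add_log_of_mem {D : Set Ω} {ω : Ω} (h : G.IsRegular μ) (hω : ω ∈ D) (hp : 0 ≤ P ω)
    (hq : 0 ≤ Q ω) :
    Real.log (1 + P ω * G.interferedGain D Q ω)
        + Real.log (1 + Q ω * G.swap.interferedGain Dᶜ P ω) =
      Real.log (jointDet (G.fst ω) (G.snd ω) (G.gram ω) (P ω) (Q ω)) := by
  rw [interferedGain_of_mem hω, interferedGain_of_notMem (Set.notMem_compl_iff.2 hω), swap,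
    log_jointDet_eq_add (h.isGain_fst.nonneg ω) (h.isGain_snd.nonneg ω) (h.gram_nonneg ω) hp hq]

/-- The chain rule for successive decoding: the user decoded first suffers interference, the other
one does not. -/
lemma payoff_add_payoff (h : G.IsRegular μ) {D : Set Ω} (hD : MeasurableSet D)
    (hP : IsPolicy μ c₁ P) (hQ : IsPolicy μ c₂ Q) :
    G.payoff μ D P Q + G.swap.payoff μ Dᶜ Q P = G.sumLog μ P Q := by
  unfold payoff logValue sumLog
  rw [← integral_add
    ((h.isGain_interferedGain hD hQ.measurable hQ.nonneg).integrable_log_one_add_mul hP)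
    ((h.swap.isGain_interferedGain hD.compl hP.measurable hP.nonneg).integrable_log_one_add_mul hQ)]
  refine integral_congr_ae (.of_forall fun ω => ?_)
  by_cases hω : ω ∈ D
  · exact log_add_log_of_mem h hω (hP.nonneg ω) (hQ.nonneg ω)
  · have hswap := log_add_log_of_mem h.swap (D := Dᶜ) hω (hQ.nonneg ω) (hP.nonneg ω)
    rw [compl_compl, swap_swap, swap, jointDet_comm, add_comm] at hswap
    exact hswap

lemma IsRegular.log_jointDet_le (h : G.IsRegular μ) {ω : Ω} (hp : 0 ≤ P ω) (hq : 0 ≤ Q ω)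
    {ε : ℝ} (hε : 0 < ε) :
    Real.log (jointDet (G.fst ω) (G.snd ω) (G.gram ω) (P ω) (Q ω)) ≤
      Real.log (1 + G.fst ω) + Real.log (1 + G.snd ω) + 2 * (ε - 1 - Real.log ε)
        + ε * (P ω + Q ω) :=
  FadingMAC.log_jointDet_le (h.isGain_fst.nonneg ω) (h.isGain_snd.nonneg ω) (h.gram_nonneg ω)
    (h.gram_le ω) hp hq hε

lemma IsRegular.log_jointDet_le_add (h : G.IsRegular μ) {ω : Ω} (hp : 0 ≤ P ω) (hq : 0 ≤ Q ω) :
    Real.log (jointDet (G.fst ω) (G.snd ω) (G.gram ω) (P ω) (Q ω)) ≤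
      Real.log (1 + G.fst ω) + Real.log (1 + G.snd ω) + (P ω + Q ω) := by
  simpa using h.log_jointDet_le hp hq one_pos

lemma IsRegular.integrable_log_jointDet (h : G.IsRegular μ) (hP : IsPolicy μ c₁ P)
    (hQ : IsPolicy μ c₂ Q) :
    Integrable (fun ω => Real.log (jointDet (G.fst ω) (G.snd ω) (G.gram ω) (P ω) (Q ω))) μ := by
  refine ((h.isGain_fst.integrable_log.add h.isGain_snd.integrable_log).add
    (hP.integrable.add hQ.integrable)).mono' ?_ (.of_forall fun ω => ?_)
  · exact ((((hP.measurable.mul h.isGain_fst.measurable).const_add 1).add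
      (hQ.measurable.mul h.isGain_snd.measurable)).add
      ((hP.measurable.mul hQ.measurable).mul h.measurable_gram)).log.aestronglyMeasurable
  · rw [Real.norm_eq_abs, abs_of_nonneg (Real.log_nonneg (one_le_jointDet (h.isGain_fst.nonneg ω)
      (h.isGain_snd.nonneg ω) (h.gram_nonneg ω) (hP.nonneg ω) (hQ.nonneg ω)))]
    exact h.log_jointDet_le_add (hP.nonneg ω) (hQ.nonneg ω)

lemma IsRegular.sumLog_le (h : G.IsRegular μ) (hP : IsPolicy μ c₁ P) (hQ : IsPolicy μ c₂ Q) :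
    G.sumLog μ P Q ≤
      ∫ ω, (Real.log (1 + G.fst ω) + Real.log (1 + G.snd ω)) ∂μ + (c₁ + c₂) := by
  have hlog := h.isGain_fst.integrable_log.add h.isGain_snd.integrable_log
  have hpower := hP.integrable.add hQ.integrable
  calc G.sumLog μ P Q
      ≤ ∫ ω, (Real.log (1 + G.fst ω) + Real.log (1 + G.snd ω) + (P ω + Q ω)) ∂μ :=
        integral_mono (h.integrable_log_jointDet hP hQ) (hlog.add hpower) fun ω =>
          h.log_jointDet_le_add (hP.nonneg ω) (hQ.nonneg ω)
    _ = ∫ ω, (Real.log (1 + G.fst ω) + Real.log (1 + G.snd ω)) ∂μ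
          + (∫ ω, P ω ∂μ + ∫ ω, Q ω ∂μ) := by
        rw [← integral_add hP.integrable hQ.integrable]
        exact integral_add hlog hpower
    _ ≤ _ := by linarith [hP.average_le, hQ.average_le]

lemma IsRegular.le_sumLog_midpoint (h : G.IsRegular μ) (hP : IsPolicy μ c₁ P)
    (hQ : IsPolicy μ c₂ Q) (hP' : IsPolicy μ c₁ P') (hQ' : IsPolicy μ c₂ Q') :
    (G.sumLog μ P Q + G.sumLog μ P' Q') / 2 ≤
      G.sumLog μ (midpoint ℝ P P') (midpoint ℝ Q Q') := by
  have hi := h.integrable_log_jointDet hP hQ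
  have hi' := h.integrable_log_jointDet hP' hQ'
  unfold sumLog
  rw [← integral_add hi hi', ← integral_div]
  refine integral_mono ((hi.add hi').div_const 2)
    (h.integrable_log_jointDet (hP.midpoint hP') (hQ.midpoint hQ')) fun ω => ?_
  have ha := h.isGain_fst.nonneg ω
  have hb := h.isGain_snd.nonneg ω
  have hd := h.gram_nonneg ω
  have hu := one_le_jointDet ha hb hd (hP.nonneg ω) (hQ.nonneg ω)
  have hv := one_le_jointDet ha hb hd (hP'.nonneg ω) (hQ'.nonneg ω)
  have hlog := Real.log_le_log (by positivity) (jointDet_mul_jointDet_le_sq_midpoint ha hb hd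
    (h.gram_le ω) (hP.nonneg ω) (hQ.nonneg ω) (hP'.nonneg ω) (hQ'.nonneg ω))
  rw [Real.log_mul (by positivity) (by positivity), Real.log_pow, Nat.cast_ofNat] at hlog
  simp only [midpoint_apply]
  linarith

lemma IsRegular.tendsto_log_jointDet (h : G.IsRegular μ) {ω : Ω} {p q : ℕ → ℝ} {p' q' : ℝ}
    (hp : Tendsto p atTop (𝓝 p')) (hq : Tendsto q atTop (𝓝 q')) (hp' : 0 ≤ p') (hq' : 0 ≤ q') :
    Tendsto (fun k => Real.log (jointDet (G.fst ω) (G.snd ω) (G.gram ω) (p k) (q k))) atTop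
      (𝓝 (Real.log (jointDet (G.fst ω) (G.snd ω) (G.gram ω) p' q'))) := by
  have hpos := one_le_jointDet (h.isGain_fst.nonneg ω) (h.isGain_snd.nonneg ω) (h.gram_nonneg ω)
    hp' hq'
  refine Tendsto.log ?_ (by positivity)
  exact (((hp.mul_const _).const_add 1).add (hq.mul_const _)).add ((hp.mul hq).mul_const _)

section existence

variable [IsFiniteMeasure μ] {z : ℕ → (Ω → ℝ) × (Ω → ℝ)} {s : ℕ → ℝ} {M : ℝ}

/-- Powers may escape to infinity along the sequence, but up to a constant they contribute only an
`ε`-fraction of themselves to the rate. -/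
lemma IsRegular.le_sumLog_of_tendsto (h : G.IsRegular μ)
    (hz₁ : ∀ k, IsPolicy μ c₁ (z k).1) (hz₂ : ∀ k, IsPolicy μ c₂ (z k).2)
    (hP : IsPolicy μ c₁ P) (hQ : IsPolicy μ c₂ Q)
    (hlim₁ : ∀ᵐ ω ∂μ, Tendsto (fun k => (z k).1 ω) atTop (𝓝 (P ω)))
    (hlim₂ : ∀ᵐ ω ∂μ, Tendsto (fun k => (z k).2 ω) atTop (𝓝 (Q ω)))
    (hs : ∀ k, s k ≤ G.sumLog μ (z k).1 (z k).2) (hsM : Tendsto s atTop (𝓝 M)) :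
    M ≤ G.sumLog μ P Q := by
  refine le_of_forall_pos_le_add fun δ hδ => ?_
  obtain ⟨ε, hε, hεδ⟩ := exists_pos_mul_lt hδ (c₁ + c₂)
  refine le_trans ?_ (add_le_add_right hεδ.le _)
  refine le_integral_add_of_tendsto
    (f := fun k ω => Real.log (jointDet (G.fst ω) (G.snd ω) (G.gram ω) ((z k).1 ω) ((z k).2 ω)))
    (g := fun k ω => ε * ((z k).1 ω + (z k).2 ω)) (G := fun ω => ε * (P ω + Q ω))
    (L := fun ω => Real.log (1 + G.fst ω) + Real.log (1 + G.snd ω) + 2 * (ε - 1 - Real.log ε))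
    (fun k => h.integrable_log_jointDet (hz₁ k) (hz₂ k))
    (fun k => ((hz₁ k).integrable.add (hz₂ k).integrable).const_mul ε)
    (h.integrable_log_jointDet hP hQ) ((hP.integrable.add hQ.integrable).const_mul ε)
    ((h.isGain_fst.integrable_log.add h.isGain_snd.integrable_log).add (integrable_const _))
    (fun k ω => h.log_jointDet_le ((hz₁ k).nonneg ω) ((hz₂ k).nonneg ω) hε)
    ?_ ?_ (.of_forall fun ω => mul_nonneg hε.le (add_nonneg (hP.nonneg ω) (hQ.nonneg ω)))
    (fun k => ?_) hs hsM
  · filter_upwards [hlim₁, hlim₂] with ω hPω hQω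
    exact h.tendsto_log_jointDet hPω hQω (hP.nonneg ω) (hQ.nonneg ω)
  · filter_upwards [hlim₁, hlim₂] with ω hPω hQω using (hPω.add hQω).const_mul ε
  · rw [integral_const_mul, integral_add (hz₁ k).integrable (hz₂ k).integrable, mul_comm]
    exact mul_le_mul_of_nonneg_right (add_le_add (hz₁ k).average_le (hz₂ k).average_le) hε.le

theorem IsRegular.exists_isSumLogMax (h : G.IsRegular μ) (hc₁ : 0 ≤ c₁) (hc₂ : 0 ≤ c₂) :
    ∃ P Q, G.IsSumLogMax μ c₁ c₂ P Q := by
  set S : Set ℝ := {v | ∃ P Q, IsPolicy μ c₁ P ∧ IsPolicy μ c₂ Q ∧ G.sumLog μ P Q = v}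
  have hS : S.Nonempty := ⟨_, 0, 0, isPolicy_zero hc₁, isPolicy_zero hc₂, rfl⟩
  have hS_bdd : BddAbove S :=
    ⟨_, by rintro _ ⟨P, Q, hP, hQ, rfl⟩; exact h.sumLog_le hP hQ⟩
  obtain ⟨s, hs_mono, hs_lim, hsS⟩ := exists_seq_tendsto_sSup hS hS_bdd
  set K : ℕ → Set ((Ω → ℝ) × (Ω → ℝ)) := fun k =>
    {z | IsPolicy μ c₁ z.1 ∧ IsPolicy μ c₂ z.2 ∧ s k ≤ G.sumLog μ z.1 z.2}
  have hK : Antitone K := fun j k hjk z hz => ⟨hz.1, hz.2.1, (hs_mono hjk).trans hz.2.2⟩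
  have hne : ∀ k, (K k).Nonempty := fun k => by
    obtain ⟨P, Q, hP, hQ, hPQ⟩ := hsS k
    exact ⟨(P, Q), hP, hQ, hPQ.ge⟩
  have hmid : ∀ k, ∀ z ∈ K k, ∀ w ∈ K k, midpoint ℝ z w ∈ K k := fun k z hz w hw => by
    rw [midpoint_mk_mk]
    exact ⟨hz.1.midpoint hw.1, hz.2.1.midpoint hw.2.1,
      le_trans (by linarith [hz.2.2, hw.2.2]) (h.le_sumLog_midpoint hz.1 hz.2.1 hw.1 hw.2.1)⟩
  obtain ⟨z, P, Q, hzK, hP, hQ, hlim₁, hlim₂⟩ := exists_seq_mem_tendsto_ae hK hne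
    (fun z hz => ⟨hz.1, hz.2.1⟩) hmid
  have hge := h.le_sumLog_of_tendsto (fun k => (hzK k).1) (fun k => (hzK k).2.1) hP hQ hlim₁ hlim₂
    (fun k => (hzK k).2.2) hs_lim
  exact ⟨P, Q, hP, hQ, fun P' Q' hP' hQ' =>
    (le_csSup hS_bdd ⟨P', Q', hP', hQ', rfl⟩).trans hge⟩

end existence

/-- When user 1 always suffers interference, the rate of user 2 does not depend on user 1, so user 1
maximizes the joint rate by maximizing its own. -/
lemma IsSumLogMax.isBestResponse (hmax : G.IsSumLogMax μ c₁ c₂ P Q) (h : G.IsRegular μ) :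
    IsBestResponse μ c₁ (G.interferedGain Set.univ Q) P := by
  refine ⟨hmax.isPolicy_fst, fun P' hP' => ?_⟩
  have hle := hmax.le P' Q hP' hmax.isPolicy_snd
  rw [← payoff_add_payoff h MeasurableSet.univ hP' hmax.isPolicy_snd,
    ← payoff_add_payoff h MeasurableSet.univ hmax.isPolicy_fst hmax.isPolicy_snd] at hle
  simpa only [payoff, Set.compl_univ, interferedGain_empty, add_le_add_iff_right] using hle

/-- When user 2 is decoded first, `P` maximizes the rate of user 1 and is the only policy to do so,
and given `P` the rate of user 2 is what is left of the joint rate. -/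
lemma IsEquilibrium.sumLog_le_of_logValue_le [IsFiniteMeasure μ] [NeZero μ]
    (hE : G.IsEquilibrium μ c₁ c₂ ∅ P Q) (h : G.IsRegular μ) (hc₁ : 0 < c₁)
    (hP' : IsPolicy μ c₁ P') (hQ' : IsPolicy μ c₂ Q')
    (hle : logValue μ G.fst P ≤ logValue μ G.fst P') : G.sumLog μ P' Q' ≤ G.sumLog μ P Q := by
  have hbest := hE.best_fst
  rw [interferedGain_empty] at hbest
  have hP : P' =ᵐ[μ] P := hbest.ae_eq_of_logValue_le h.isGain_fst hc₁ hP' hle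
  have hsum : G.sumLog μ P' Q' = G.sumLog μ P Q' := integral_congr_ae <| by
    filter_upwards [hP] with ω hω
    rw [hω]
  rw [hsum, ← payoff_add_payoff h MeasurableSet.empty hbest.isPolicy hQ',
    ← payoff_add_payoff h MeasurableSet.empty hbest.isPolicy hE.best_snd.isPolicy, payoff,
    interferedGain_empty, payoff, payoff, interferedGain_empty]
  gcongr
  exact hE.best_snd.le Q' hQ'

end GainPair

/-! ### Time sharing at the maximum of the sum-rate -/

/-- The relation between the gains `a`, `b` and the Gram determinant `d` that makes the two users
transmit simultaneously, where user 1 has water level `x` and user 2 has water level `y` without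
interference and `y + k` with interference. It is obtained by eliminating the powers. -/
def IsCoupled (x y k a b d : ℝ) : Prop :=
  (x * (y * (b * d) + (a * b - d)) - y * b ^ 2) * ((a * b - d) - k * (b * d))
    = k * b ^ 2 * (y * (b * d) + (a * b - d))

/-- The user with gain `b` and water level `y` stays silent against water-filling at level `x` over
the gain `a`; the inequality is obtained by eliminating the power. -/
def Silences (x y a b d : ℝ) : Prop := y * (x * (a * d) + (a * b - d)) ≤ x * a ^ 2

section levels

variable {a b d p q x y z : ℝ}

lemma inv_effectiveGain : (effectiveGain a b d q)⁻¹ = (1 + q * b) / (a + q * d) := inv_div _ _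

lemma isCoupled_of_levels (ha : 0 < a) (hb : 0 < b) (hd : 0 ≤ d) (hdab : d < a * b) (hp : 0 < p)
    (hq : 0 < q) (hpx : p = x - (effectiveGain a b d q)⁻¹) (hqy : q = y - b⁻¹)
    (hqz : q = z - (effectiveGain b a d p)⁻¹) :
    0 < z - y ∧ IsCoupled x y (z - y) a b d := by
  rw [inv_effectiveGain] at hpx hqz
  obtain ⟨k, rfl⟩ : ∃ k, z = y + k := ⟨z - y, by ring⟩
  rw [add_sub_cancel_left]
  have hk : k * (b * (b + p * d)) = p * (a * b - d) := by
    have hk' : k = (1 + p * a) / (b + p * d) - b⁻¹ := by linarith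
    rw [hk']
    field_simp
    ring
  have hk_pos : 0 < k :=
    pos_of_mul_pos_left (hk ▸ mul_pos hp (sub_pos.2 hdab)) (by positivity)
  have hy : y * b = 1 + q * b := by
    rw [hqy]
    field_simp
    ring
  have hinterference : y * (b * d) + (a * b - d) = b * (a + q * d) := by
    linear_combination d * hy
  have hpower : p * (a + q * d) = x * (a + q * d) - y * b := by
    rw [hpx, sub_mul, div_mul_cancel₀ _ (by positivity), hy]
  refine ⟨hk_pos, ?_⟩
  unfold IsCoupled
  rw [hinterference]
  linear_combination (-(b * (a * b - d - k * (b * d)))) * hpower - b * (a + q * d) * hk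

/-- Dividing the relation by `s`, or setting `s = 1`, leaves two instances that differ only in one
term; they force `a * b - d = k * (b * d)`, for which the relation fails. -/
lemma not_isCoupled_mul {k s : ℝ} (hb : 0 < b) (hd : 0 ≤ d) (hdab : d < a * b) (hx : 0 < x)
    (hy : 0 < y) (hk : 0 < k) (hs : 1 < s) (h : IsCoupled x y k a b d) :
    ¬ IsCoupled x y k (s * a) b (s * d) := by
  intro hmul
  unfold IsCoupled at h hmul
  have hX : 0 < y * (b * d) + (a * b - d) := by
    have := sub_pos.2 hdab
    positivity
  set X := y * (b * d) + (a * b - d) with hX_def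
  set Y := (a * b - d) - k * (b * d) with hY_def
  have hdiv : (x * (s * X) - y * b ^ 2) * Y = k * b ^ 2 * X := by
    refine mul_left_cancel₀ (show s ≠ 0 by positivity) ?_
    rw [hX_def, hY_def]
    linear_combination hmul
  have hsub : x * X * (s - 1) * Y = 0 := by linear_combination hdiv - h
  have hY : Y = 0 :=
    (mul_eq_zero.1 hsub).resolve_left (mul_pos (mul_pos hx hX) (sub_pos.2 hs)).ne'
  rw [hY, mul_zero] at h
  exact (show 0 < k * b ^ 2 * X by positivity).ne h

lemma one_lt_mul_of_waterfill_pos (ha : 0 < a) (h : 0 < waterfill x a) : 1 < x * a := by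
  rw [waterfill_eq_of_pos h, sub_pos, inv_lt_iff_one_lt_mul₀ ha] at h
  exact h

lemma silences_of_waterfill_eq_zero (ha : 0 < a) (hb : 0 < b) (hd : 0 ≤ d) (hy : 0 ≤ y)
    (hpos : 0 < waterfill x a) (h : waterfill y (effectiveGain b a d (waterfill x a)) = 0) :
    y * b ≤ x * a ∧ Silences x y a b d := by
  have hp := waterfill_eq_of_pos hpos
  set p := waterfill x a
  have hxa : x * a = 1 + p * a := by
    rw [hp]
    field_simp
    ring
  have hle := waterfill_eq_zero_iff.1 h
  rw [inv_effectiveGain, le_div_iff₀ (by positivity), ← hxa] at hle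
  refine ⟨by linarith [mul_nonneg hy (mul_nonneg hpos.le hd)], ?_⟩
  have hle' := mul_le_mul_of_nonneg_left hle ha.le
  unfold Silences
  linear_combination hle' + y * d * hxa

lemma not_silences_of_mul_eq (hd : 0 < d) (hy : 0 < y) (hxa : 1 < x * a) (hxy : x * a = y * b) :
    ¬ Silences x y a b d := by
  have : 0 < x * a - 1 := sub_pos.2 hxa
  have hgap : y * (x * (a * d) + (a * b - d)) = x * a ^ 2 + y * d * (x * a - 1) := by
    linear_combination -a * hxy
  rw [Silences, hgap, not_le, lt_add_iff_pos_right]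
  positivity

end levels

lemma frequently_pos_of_integral_pos {Ω : Type*} [MeasurableSpace Ω] {μ : Measure Ω} {f : Ω → ℝ}
    (h : 0 < ∫ ω, f ω ∂μ) : ∃ᵐ ω ∂μ, 0 < f ω := by
  intro hf
  refine h.not_ge (integral_nonpos_of_ae ?_)
  filter_upwards [hf] with ω hω using not_lt.1 hω

namespace GainPair

variable {Ω : Type*} [MeasurableSpace Ω] {μ : Measure Ω} {G : GainPair Ω} {c₁ c₂ : ℝ}
  {D : Set Ω} {P Q : Ω → ℝ}

/-- The joint law of the gains and the Gram determinant charges neither the linearly dependent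
channels nor the coupling relations. -/
structure IsGeneric (G : GainPair Ω) (μ : Measure Ω) : Prop where
  gram_lt : ∀ᵐ ω ∂μ, G.gram ω < G.fst ω * G.snd ω
  not_isCoupled : ∀ x y k, 0 < x → 0 < y → 0 < k →
    ∀ᵐ ω ∂μ, ¬ IsCoupled x y k (G.fst ω) (G.snd ω) (G.gram ω)
  not_isCoupled_swap : ∀ x y k, 0 < x → 0 < y → 0 < k →
    ∀ᵐ ω ∂μ, ¬ IsCoupled x y k (G.snd ω) (G.fst ω) (G.gram ω)

lemma IsGeneric.swap (hG : G.IsGeneric μ) : G.swap.IsGeneric μ :=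
  ⟨hG.gram_lt.mono fun _ hω => hω.trans_eq (mul_comm _ _), hG.not_isCoupled_swap,
    hG.not_isCoupled⟩

lemma ae_silences_of_pos (h : G.IsRegular μ) {x y : ℝ} (hy : 0 < y)
    (hPx : ∀ᵐ ω ∂μ, P ω = waterfill x (effectiveGain (G.fst ω) (G.snd ω) (G.gram ω) (Q ω)))
    (hQy : ∀ᵐ ω ∂μ, Q ω = waterfill y (effectiveGain (G.snd ω) (G.fst ω) (G.gram ω) (P ω)))
    (hsilent : ∀ᵐ ω ∂μ, P ω = 0 ∨ Q ω = 0) :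
    ∀ᵐ ω ∂μ, 0 < P ω → 1 < x * G.fst ω ∧ y * G.snd ω ≤ x * G.fst ω ∧
      Silences x y (G.fst ω) (G.snd ω) (G.gram ω) := by
  filter_upwards [hPx, hQy, hsilent, h.isGain_fst.pos, h.isGain_snd.pos]
    with ω hPω hQω hs hfst hsnd hp
  have hq : Q ω = 0 := hs.resolve_left hp.ne'
  rw [hq, effectiveGain_zero] at hPω
  rw [hq, hPω] at hQω
  rw [hPω] at hp
  exact ⟨one_lt_mul_of_waterfill_pos hfst hp,
    silences_of_waterfill_eq_zero hfst hsnd (h.gram_nonneg ω) hy.le hp hQω.symm⟩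

variable [IsFiniteMeasure μ] [NeZero μ]

/-- Where both users transmit on `D`, user 2 water-fills at two different levels over its clean and
its interfered gain, which couples the gains. -/
lemma IsEquilibrium.ae_mem_imp_eq_zero_or_eq_zero (hE : G.IsEquilibrium μ c₁ c₂ D P Q)
    (h : G.IsRegular μ) (hG : G.IsGeneric μ) (hD : MeasurableSet D) (hc₁ : 0 < c₁) (hc₂ : 0 < c₂)
    (hQ : IsBestResponse μ c₂ (G.swap.interferedGain Set.univ P) Q) :
    ∀ᵐ ω ∂μ, ω ∈ D → P ω = 0 ∨ Q ω = 0 := by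
  obtain ⟨x, hx, -, hPx⟩ := hE.best_fst.exists_eq_waterfill (hE.isGain h hD) hc₁
  obtain ⟨y, hy, -, hQy⟩ := hE.best_snd.exists_eq_waterfill (hE.swap.isGain h.swap hD.compl) hc₂
  obtain ⟨z, -, -, hQz⟩ := hQ.exists_eq_waterfill (h.swap.isGain_interferedGain .univ
    hE.best_fst.isPolicy.measurable hE.best_fst.isPolicy.nonneg) hc₂
  have hcoupled : ∀ᵐ ω ∂μ, 0 < z - y →
      ¬ IsCoupled x y (z - y) (G.fst ω) (G.snd ω) (G.gram ω) :=
    eventually_imp_distrib_left.2 fun hk => hG.not_isCoupled x y (z - y) hx hy hk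
  filter_upwards [hPx, hQy, hQz, hcoupled, hG.gram_lt, h.isGain_fst.pos, h.isGain_snd.pos]
    with ω hPω hQω hQω' hcoupled hlt hfst hsnd hω
  by_contra! hne
  have hp : 0 < P ω := (hE.best_fst.isPolicy.nonneg ω).lt_of_ne' hne.1
  have hq : 0 < Q ω := (hE.best_snd.isPolicy.nonneg ω).lt_of_ne' hne.2
  rw [waterfill_eq_of_pos (hPω ▸ hp), interferedGain_of_mem hω] at hPω
  rw [waterfill_eq_of_pos (hQω ▸ hq), interferedGain_of_notMem (Set.notMem_compl_iff.2 hω)] at hQω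
  rw [waterfill_eq_of_pos (hQω' ▸ hq), interferedGain_of_mem (Set.mem_univ ω)] at hQω'
  obtain ⟨hk, hIsCoupled⟩ :=
    isCoupled_of_levels hfst hsnd (h.gram_nonneg ω) hlt hp hq hPω hQω hQω'
  exact hcoupled hk hIsCoupled

theorem IsEquilibrium.ae_eq_zero_or_eq_zero (hE : G.IsEquilibrium μ c₁ c₂ D P Q)
    (h : G.IsRegular μ) (hG : G.IsGeneric μ) (hD : MeasurableSet D) (hc₁ : 0 < c₁) (hc₂ : 0 < c₂)
    (hmax : G.IsSumLogMax μ c₁ c₂ P Q) : ∀ᵐ ω ∂μ, P ω = 0 ∨ Q ω = 0 := by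
  filter_upwards [hE.ae_mem_imp_eq_zero_or_eq_zero h hG hD hc₁ hc₂
      (hmax.swap.isBestResponse h.swap),
    hE.swap.ae_mem_imp_eq_zero_or_eq_zero h.swap hG.swap hD.compl hc₂ hc₁
      (hmax.isBestResponse h)] with ω hmem hnotMem
  by_cases hω : ω ∈ D
  · exact hmem hω
  · exact (hnotMem hω).symm

lemma IsSumLogMax.exists_level (hmax : G.IsSumLogMax μ c₁ c₂ P Q) (h : G.IsRegular μ)
    (hc₁ : 0 < c₁) : ∃ x, 0 < x ∧ ∫ ω, P ω ∂μ = c₁ ∧ ∀ᵐ ω ∂μ,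
      P ω = waterfill x (effectiveGain (G.fst ω) (G.snd ω) (G.gram ω) (Q ω)) := by
  obtain ⟨x, hx, hi, hPx⟩ := (hmax.isBestResponse h).exists_eq_waterfill
    (h.isGain_interferedGain .univ hmax.isPolicy_snd.measurable hmax.isPolicy_snd.nonneg) hc₁
  refine ⟨x, hx, by rw [integral_congr_ae hPx, hi], ?_⟩
  filter_upwards [hPx] with ω hω
  rw [hω, interferedGain_of_mem (Set.mem_univ ω)]

theorem IsSumLogMax.exists_levels_silences (hmax : G.IsSumLogMax μ c₁ c₂ P Q)
    (h : G.IsRegular μ) (hc₁ : 0 < c₁) (hc₂ : 0 < c₂)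
    (hsilent : ∀ᵐ ω ∂μ, P ω = 0 ∨ Q ω = 0) :
    ∃ x y, 0 < x ∧ 0 < y ∧
      (∀ᵐ ω ∂μ, 1 < x * G.fst ω → Silences x y (G.fst ω) (G.snd ω) (G.gram ω) ∨
        Silences y x (G.snd ω) (G.fst ω) (G.gram ω)) ∧
      (∃ᵐ ω ∂μ, 1 < x * G.fst ω ∧ y * G.snd ω ≤ x * G.fst ω) ∧
      (∃ᵐ ω ∂μ, 1 < y * G.snd ω ∧ x * G.fst ω ≤ y * G.snd ω) := by
  obtain ⟨x, hx, hPi, hPx⟩ := hmax.exists_level h hc₁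
  obtain ⟨y, hy, hQi, hQy⟩ := hmax.swap.exists_level h.swap hc₂
  have hfst := ae_silences_of_pos h hy hPx hQy hsilent
  have hsnd := ae_silences_of_pos h.swap hx hQy hPx (hsilent.mono fun _ => Or.symm)
  refine ⟨x, y, hx, hy, ?_, ?_, ?_⟩
  · filter_upwards [hPx, hfst, hsnd, h.isGain_fst.pos] with ω hPω hfst hsnd ha hxa
    rcases (hmax.isPolicy_fst.nonneg ω).lt_or_eq with hp | hp
    · exact .inl (hfst hp).2.2
    rcases (hmax.isPolicy_snd.nonneg ω).lt_or_eq with hq | hq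
    · exact .inr (hsnd hq).2.2
    rw [← hq, effectiveGain_zero, ← hp, eq_comm, waterfill_eq_zero_iff] at hPω
    exact absurd ((inv_lt_iff_one_lt_mul₀ ha).2 hxa) hPω.not_gt
  · exact (frequently_pos_of_integral_pos (hPi ▸ hc₁)).mp
      (hfst.mono fun ω hω hp => ⟨(hω hp).1, (hω hp).2.1⟩)
  · exact (frequently_pos_of_integral_pos (hQi ▸ hc₂)).mp
      (hsnd.mono fun ω hω hp => ⟨(hω hp).1, (hω hp).2.1⟩)

end GainPair

end FadingMAC

namespace VectorMAC

open FadingMAC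
open scoped RealInnerProductSpace Pointwise Matrix

/-! ### The vector channel -/

lemma det_one_add_smul_vecMulVec_add {ι : Type*} [Fintype ι] [DecidableEq ι] (u v : ι → ℝ)
    (p q : ℝ) :
    (1 + (p • Matrix.vecMulVec u u + q • Matrix.vecMulVec v v)).det =
      jointDet (u ⬝ᵥ u) (v ⬝ᵥ v) ((u ⬝ᵥ u) * (v ⬝ᵥ v) - (u ⬝ᵥ v) ^ 2) p q := by
  have hmul : p • Matrix.vecMulVec u u + q • Matrix.vecMulVec v v =
      (Matrix.of ![u, v])ᵀ * Matrix.of ![p • u, q • v] := by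
    ext i j
    simp only [Matrix.add_apply, Matrix.smul_apply, Matrix.vecMulVec_apply, smul_eq_mul,
      Matrix.mul_apply, Matrix.transpose_apply, Matrix.of_apply, Matrix.cons_val',
      Matrix.cons_val_fin_one, Pi.smul_apply, Fin.sum_univ_two, Matrix.cons_val_zero,
      Matrix.cons_val_one]
    ring
  have hgram : Matrix.of ![p • u, q • v] * (Matrix.of ![u, v])ᵀ =
      !![p * (u ⬝ᵥ u), p * (u ⬝ᵥ v); q * (u ⬝ᵥ v), q * (v ⬝ᵥ v)] := by
    ext i j
    fin_cases i <;> fin_cases j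
    · exact smul_dotProduct p u u
    · exact smul_dotProduct p u v
    · exact (smul_dotProduct q v u).trans (by rw [dotProduct_comm v u, smul_eq_mul]; rfl)
    · exact smul_dotProduct q v v
  rw [hmul, Matrix.det_one_add_mul_comm, hgram, Matrix.det_fin_two, jointDet]
  simp only [Matrix.add_apply, Matrix.one_apply_eq, Matrix.of_apply, Matrix.cons_val',
    Matrix.cons_val_zero, Matrix.cons_val_fin_one, Matrix.cons_val_one, Matrix.one_apply_ne,
    zero_add, ne_eq, zero_ne_one, one_ne_zero, not_false_eq_true]
  ring

variable {n : ℕ} (C : VectorMAC n)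

/-- The gains of the users relative to the noise variance, and the Gram determinant of the channel
vectors, in the same normalization. -/
noncomputable def gains (C : VectorMAC n) : GainPair (FadingState n) where
  fst H := ‖H.1‖ ^ 2 / C.noiseVar
  snd H := ‖H.2‖ ^ 2 / C.noiseVar
  gram H := (‖H.1‖ ^ 2 * ‖H.2‖ ^ 2 - ⟪H.1, H.2⟫ ^ 2) / C.noiseVar ^ 2

/-- Conversion factor from natural logarithms to rates in bits per real dimension. -/
noncomputable def bitRate : ℝ := 1 / 2 / Real.log 2

lemma bitRate_pos : 0 < bitRate := div_pos one_half_pos (Real.log_pos one_lt_two)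

variable {C}

lemma gains_fst_nonneg (hs : 0 ≤ C.noiseVar) (H : FadingState n) : 0 ≤ C.gains.fst H := by
  unfold gains; positivity

lemma gains_snd_nonneg (hs : 0 ≤ C.noiseVar) (H : FadingState n) : 0 ≤ C.gains.snd H := by
  unfold gains; positivity

lemma gains_gram_nonneg (H : FadingState n) : 0 ≤ C.gains.gram H := by
  refine div_nonneg (sub_nonneg.2 ?_) (sq_nonneg _)
  rw [← mul_pow]
  exact sq_le_sq.2 ((abs_real_inner_le_norm _ _).trans (le_abs_self _))

lemma gains_mul_sub_gram (H : FadingState n) :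
    C.gains.fst H * C.gains.snd H - C.gains.gram H = ⟪H.1, H.2⟫ ^ 2 / C.noiseVar ^ 2 := by
  unfold gains
  ring

lemma det_one_add_noiseVar_inv_smul (hs : C.noiseVar ≠ 0) (p q : ℝ) (H : FadingState n) :
    (1 + C.noiseVar⁻¹ • (p • Matrix.vecMulVec (fun k => H.1 k) (fun k => H.1 k)
        + q • Matrix.vecMulVec (fun k => H.2 k) (fun k => H.2 k))).det =
      jointDet (C.gains.fst H) (C.gains.snd H) (C.gains.gram H) p q := by
  have hdot : ∀ u v : EuclideanSpace ℝ (Fin n), (fun k => u k) ⬝ᵥ (fun k => v k) = ⟪u, v⟫ :=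
    fun u v => by rw [EuclideanSpace.inner_eq_star_dotProduct, star_trivial, dotProduct_comm]
  rw [smul_add, smul_smul, smul_smul, det_one_add_smul_vecMulVec_add, hdot, hdot, hdot,
    real_inner_self_eq_norm_sq, real_inner_self_eq_norm_sq]
  unfold jointDet gains
  field_simp

lemma det_receivedCov (hs : C.noiseVar ≠ 0) (p q : ℝ) (H : FadingState n) :
    (C.receivedCov p q H).det =
      C.noiseVar ^ n * jointDet (C.gains.fst H) (C.gains.snd H) (C.gains.gram H) p q := by
  have hcov : C.receivedCov p q H =
      C.noiseVar • (1 + C.noiseVar⁻¹ • (p • Matrix.vecMulVec (fun k => H.1 k) (fun k => H.1 k)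
        + q • Matrix.vecMulVec (fun k => H.2 k) (fun k => H.2 k))) := by
    rw [smul_add, smul_inv_smul₀ hs, ← add_assoc, receivedCov]
  rw [hcov, Matrix.det_smul, Fintype.card_fin, det_one_add_noiseVar_inv_smul hs]

lemma sumInfo_eq (hs : C.noiseVar ≠ 0) (P Q : FadingState n → ℝ) :
    C.sumInfo P Q = bitRate * C.gains.sumLog C.law P Q := by
  unfold sumInfo GainPair.sumLog
  rw [← integral_const_mul]
  congr 1 with H
  rw [det_one_add_noiseVar_inv_smul hs, Real.logb, bitRate]
  ring

lemma half_logb_mul_sub_half_logb_mul {s a b d p q : ℝ} (hs : 0 < s) (ha : 0 ≤ a) (hb : 0 ≤ b)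
    (hd : 0 ≤ d) (hp : 0 ≤ p) (hq : 0 ≤ q) :
    1 / 2 * Real.logb 2 (s * jointDet a b d p q) - 1 / 2 * Real.logb 2 (s * jointDet a b d 0 q) =
      bitRate * Real.log (1 + p * effectiveGain a b d q) := by
  have hone : ∀ r, 0 ≤ r → jointDet a b d r q ≠ 0 := fun r hr =>
    (one_pos.trans_le (one_le_jointDet ha hb hd hr hq)).ne'
  rw [Real.logb, Real.logb, Real.log_mul hs.ne' (hone p hp), Real.log_mul hs.ne' (hone 0 le_rfl),
    log_jointDet_eq_add ha hb hd hp hq, log_jointDet_eq_add ha hb hd le_rfl hq, bitRate, zero_mul,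
    add_zero, Real.log_one]
  ring

lemma rate₁_eq (hs : 0 < C.noiseVar) (D : Set (FadingState n)) {P Q : FadingState n → ℝ}
    (hP : ∀ H, 0 ≤ P H) (hQ : ∀ H, 0 ≤ Q H) :
    C.rate₁ D P Q = bitRate * C.gains.payoff C.law D P Q := by
  unfold rate₁ GainPair.payoff logValue
  rw [← integral_const_mul]
  congr 1 with H
  rw [det_receivedCov hs.ne', det_receivedCov hs.ne']
  exact half_logb_mul_sub_half_logb_mul (pow_pos hs n) (gains_fst_nonneg hs.le H)
    (gains_snd_nonneg hs.le H) (gains_gram_nonneg H) (hP H)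
    (Set.indicator_nonneg (fun H _ => hQ H) H)

lemma rate₂_eq (hs : 0 < C.noiseVar) (D : Set (FadingState n)) {P Q : FadingState n → ℝ}
    (hP : ∀ H, 0 ≤ P H) (hQ : ∀ H, 0 ≤ Q H) :
    C.rate₂ D P Q = bitRate * C.gains.swap.payoff C.law Dᶜ Q P := by
  unfold rate₂ GainPair.payoff logValue
  rw [← integral_const_mul]
  congr 1 with H
  rw [det_receivedCov hs.ne', det_receivedCov hs.ne', ← jointDet_comm,
    ← jointDet_comm (p := Dᶜ.indicator P H)]
  exact half_logb_mul_sub_half_logb_mul (pow_pos hs n) (gains_snd_nonneg hs.le H)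
    (gains_fst_nonneg hs.le H) (gains_gram_nonneg H) (hQ H)
    (Set.indicator_nonneg (fun H _ => hP H) H)

lemma isFeasible_iff_isPolicy {c : ℝ} {P : FadingState n → ℝ} :
    C.IsFeasible c P ↔ IsPolicy C.law c P :=
  ⟨fun h => ⟨h.1, h.2, h.3, h.4⟩, fun h => ⟨h.1, h.2, h.3, h.4⟩⟩

lemma isNash_iff_isEquilibrium (hs : 0 < C.noiseVar) {D : Set (FadingState n)}
    {P Q : FadingState n → ℝ} :
    C.IsNash D P Q ↔ C.gains.IsEquilibrium C.law C.power₁ C.power₂ D P Q := by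
  have hfst : ∀ {R}, IsPolicy C.law C.power₁ P → IsPolicy C.law C.power₁ R →
      IsPolicy C.law C.power₂ Q → (C.rate₁ D R Q ≤ C.rate₁ D P Q ↔
        C.gains.payoff C.law D R Q ≤ C.gains.payoff C.law D P Q) := fun hP hR hQ => by
    rw [rate₁_eq hs D hR.nonneg hQ.nonneg, rate₁_eq hs D hP.nonneg hQ.nonneg,
      mul_le_mul_iff_right₀ bitRate_pos]
  have hsnd : ∀ {R}, IsPolicy C.law C.power₁ P → IsPolicy C.law C.power₂ Q →
      IsPolicy C.law C.power₂ R → (C.rate₂ D P R ≤ C.rate₂ D P Q ↔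
        C.gains.swap.payoff C.law Dᶜ R P ≤ C.gains.swap.payoff C.law Dᶜ Q P) :=
    fun hP hQ hR => by
      rw [rate₂_eq hs D hP.nonneg hR.nonneg, rate₂_eq hs D hP.nonneg hQ.nonneg,
        mul_le_mul_iff_right₀ bitRate_pos]
  constructor
  · rintro ⟨hP, hQ, hbest₁, hbest₂⟩
    rw [isFeasible_iff_isPolicy] at hP hQ
    exact ⟨⟨hP, fun R hR => (hfst hP hR hQ).1 (hbest₁ R (isFeasible_iff_isPolicy.2 hR))⟩,
      ⟨hQ, fun R hR => (hsnd hP hQ hR).1 (hbest₂ R (isFeasible_iff_isPolicy.2 hR))⟩⟩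
  · rintro ⟨⟨hP, hbest₁⟩, ⟨hQ, hbest₂⟩⟩
    refine ⟨isFeasible_iff_isPolicy.2 hP, isFeasible_iff_isPolicy.2 hQ, fun R hR => ?_,
      fun R hR => ?_⟩
    · rw [isFeasible_iff_isPolicy] at hR
      exact (hfst hP hR hQ).2 (hbest₁ R hR)
    · rw [isFeasible_iff_isPolicy] at hR
      exact (hsnd hP hQ hR).2 (hbest₂ R hR)

/-! ### Null sets of fading states -/

section Haar

variable {E : Type*} [NormedAddCommGroup E] [MeasurableSpace E] [BorelSpace E]

/-- The dilates `r • T` with `r ∈ [1, 2]` are infinitely many disjoint subsets of a bounded set, and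
none of them has smaller measure than `T`. -/
lemma addHaar_eq_zero_of_smul_notMem_of_isBounded [NormedSpace ℝ E] [FiniteDimensional ℝ E]
    (μ : Measure E) [μ.IsAddHaarMeasure] {T : Set E} (hT : MeasurableSet T)
    (hT_bdd : Bornology.IsBounded T) (hray : ∀ h ∈ T, ∀ t : ℝ, 1 < t → t • h ∉ T) : μ T = 0 := by
  by_contra hne
  have hpos : ∀ r : Set.Icc (1 : ℝ) 2, 0 < (r : ℝ) := fun r => one_pos.trans_le r.2.1
  have hdisj : ∀ r s : Set.Icc (1 : ℝ) 2, r < s → Disjoint ((s : ℝ) • T) ((r : ℝ) • T) := by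
    intro r s hrs
    rw [Set.disjoint_left]
    rintro _ ⟨h, hh, rfl⟩ ⟨h', hh', heq⟩
    refine hray h hh (s / r) ((one_lt_div (hpos r)).2 hrs) ?_
    rwa [div_eq_inv_mul, mul_smul, ← show (r : ℝ) • h' = (s : ℝ) • h from heq,
      inv_smul_smul₀ (hpos r).ne']
  obtain ⟨R, hR⟩ := hT_bdd.subset_closedBall 0
  have hbdd : ⋃ r : Set.Icc (1 : ℝ) 2, (r : ℝ) • T ⊆ Metric.closedBall 0 (2 * R) := by
    refine Set.iUnion_subset fun r => ?_
    rintro _ ⟨h, hh, rfl⟩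
    have hhR : ‖h‖ ≤ R := by simpa using hR hh
    simp only [mem_closedBall_zero_iff, norm_smul, Real.norm_eq_abs, abs_of_pos (hpos r)]
    exact mul_le_mul r.2.2 hhR (norm_nonneg _) zero_le_two
  have hfin := Measure.finite_const_le_meas_of_disjoint_iUnion μ (pos_iff_ne_zero.2 hne)
    (fun r : Set.Icc (1 : ℝ) 2 => hT.const_smul_of_ne_zero (hpos r).ne')
    (fun r s hrs => (lt_or_gt_of_ne hrs).elim (fun h => (hdisj r s h).symm) (hdisj s r))
    (measure_ne_top_of_subset hbdd measure_closedBall_lt_top.ne)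
  have huniv : {r : Set.Icc (1 : ℝ) 2 | μ T ≤ μ ((r : ℝ) • T)} = Set.univ := by
    refine Set.eq_univ_of_forall fun r => ?_
    rw [Set.mem_ofPred_eq, Measure.addHaar_smul]
    refine le_mul_of_one_le_left zero_le (ENNReal.one_le_ofReal.2 ?_)
    exact (one_le_pow₀ r.2.1).trans (le_abs_self _)
  rw [huniv, Set.finite_univ_iff, Set.finite_coe_iff] at hfin
  exact Set.Icc_infinite one_lt_two hfin

lemma addHaar_eq_zero_of_smul_notMem [NormedSpace ℝ E] [FiniteDimensional ℝ E] (μ : Measure E)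
    [μ.IsAddHaarMeasure] {T : Set E} (hT : MeasurableSet T)
    (hray : ∀ h ∈ T, ∀ t : ℝ, 1 < t → t • h ∉ T) : μ T = 0 := by
  rw [← Metric.iUnion_inter_closedBall_nat T 0]
  exact measure_iUnion_null fun R => addHaar_eq_zero_of_smul_notMem_of_isBounded μ
    (hT.inter measurableSet_closedBall) (Metric.isBounded_closedBall.subset Set.inter_subset_right)
    fun h hh t ht hmem => hray h hh.1 t ht hmem.1

lemma ae_inner_ne_zero [InnerProductSpace ℝ E] [FiniteDimensional ℝ E] (μ ν : Measure E)
    [NullSingletonClass μ] [ν.IsAddHaarMeasure] : ∀ᵐ H ∂μ.prod ν, ⟪H.1, H.2⟫ ≠ 0 := by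
  rw [Measure.ae_prod_iff_ae_ae
    (isOpen_ne_fun (continuous_fst.inner continuous_snd) continuous_const).measurableSet]
  filter_upwards [μ.ae_ne 0] with h hh
  have hker : LinearMap.ker (innerSL ℝ h).toLinearMap ≠ ⊤ := fun htop => by
    have hmem : h ∈ LinearMap.ker (innerSL ℝ h).toLinearMap := htop ▸ Submodule.mem_top
    exact hh (by simpa using hmem)
  exact measure_eq_zero_iff_ae_notMem.1 (Measure.addHaar_submodule ν _ hker)

end Haar

lemma ae_inner_ne_zero_of_absolutelyContinuous (hn : 1 ≤ n) (hdensity : C.law ≪ volume) :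
    ∀ᵐ H ∂C.law, ⟪H.1, H.2⟫ ≠ 0 := by
  have : Nonempty (Fin n) := ⟨⟨0, hn⟩⟩
  exact hdensity.ae_le (ae_inner_ne_zero volume volume)

lemma gains_fst_pos (hs : 0 < C.noiseVar) {H : FadingState n} (hH : ⟪H.1, H.2⟫ ≠ 0) :
    0 < C.gains.fst H := by
  have : H.1 ≠ 0 := fun h => hH (by rw [h, inner_zero_left])
  unfold gains
  positivity

lemma gains_snd_pos (hs : 0 < C.noiseVar) {H : FadingState n} (hH : ⟪H.1, H.2⟫ ≠ 0) :
    0 < C.gains.snd H := by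
  have : H.2 ≠ 0 := fun h => hH (by rw [h, inner_zero_right])
  unfold gains
  positivity

lemma gains_gram_lt (hs : C.noiseVar ≠ 0) {H : FadingState n} (hH : ⟪H.1, H.2⟫ ≠ 0) :
    C.gains.gram H < C.gains.fst H * C.gains.snd H := by
  rw [← sub_pos, gains_mul_sub_gram]
  positivity

@[fun_prop]
lemma continuous_gains_fst : Continuous C.gains.fst := by unfold gains; fun_prop

@[fun_prop]
lemma continuous_gains_snd : Continuous C.gains.snd := by unfold gains; fun_prop

@[fun_prop]
lemma continuous_gains_gram : Continuous C.gains.gram := by unfold gains; fun_prop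

lemma not_isCoupled_smul_snd (hs : 0 < C.noiseVar) {x y k t : ℝ} (hx : 0 < x) (hy : 0 < y)
    (hk : 0 < k) (ht : 1 < t) {h₁ h₂ : EuclideanSpace ℝ (Fin n)} (hinner : ⟪h₁, h₂⟫ ≠ 0)
    (h : IsCoupled x y k (C.gains.snd (h₁, h₂)) (C.gains.fst (h₁, h₂)) (C.gains.gram (h₁, h₂))) :
    ¬ IsCoupled x y k (C.gains.snd (h₁, t • h₂)) (C.gains.fst (h₁, t • h₂))
      (C.gains.gram (h₁, t • h₂)) := by
  have hsnd : C.gains.snd (h₁, t • h₂) = t ^ 2 * C.gains.snd (h₁, h₂) := by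
    simp [gains, norm_smul, mul_pow, mul_div_assoc]
  have hgram : C.gains.gram (h₁, t • h₂) = t ^ 2 * C.gains.gram (h₁, h₂) := by
    simp only [gains, Real.norm_eq_abs, sq_abs, norm_smul, inner_smul_right, mul_pow]
    ring
  have hfst : C.gains.fst (h₁, t • h₂) = C.gains.fst (h₁, h₂) := rfl
  rw [hfst, hsnd, hgram]
  exact not_isCoupled_mul (gains_fst_pos hs hinner) (gains_gram_nonneg _)
    (mul_comm (C.gains.snd (h₁, h₂)) _ ▸ gains_gram_lt hs.ne' hinner) hx hy hk
    (one_lt_pow₀ ht two_ne_zero) h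

lemma ae_not_isCoupled_swap (hn : 1 ≤ n) (hs : 0 < C.noiseVar) {x y k : ℝ} (hx : 0 < x)
    (hy : 0 < y) (hk : 0 < k) :
    ∀ᵐ H : FadingState n, ¬ IsCoupled x y k (C.gains.snd H) (C.gains.fst H) (C.gains.gram H) := by
  have : Nonempty (Fin n) := ⟨⟨0, hn⟩⟩
  let T : Set (FadingState n) :=
    {H | ⟪H.1, H.2⟫ ≠ 0 ∧ IsCoupled x y k (C.gains.snd H) (C.gains.fst H) (C.gains.gram H)}
  have hmeas : MeasurableSet T := by
    exact (isOpen_ne_fun (by fun_prop) continuous_const).measurableSet.inter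
      (isClosed_eq (by fun_prop) (by fun_prop)).measurableSet
  have hnull : ∀ᵐ H : FadingState n, H ∉ T := by
    rw [Measure.volume_eq_prod, Measure.ae_prod_iff_ae_ae hmeas.compl]
    refine .of_forall fun h₁ => measure_eq_zero_iff_ae_notMem.1 (addHaar_eq_zero_of_smul_notMem
      volume (measurable_prodMk_left hmeas) ?_)
    exact fun h₂ hh₂ t ht hmem => not_isCoupled_smul_snd hs hx hy hk ht hh₂.1 hh₂.2 hmem.2
  filter_upwards [hnull, ae_inner_ne_zero volume volume] with H hH hinner hcoupled
  exact hH ⟨hinner, hcoupled⟩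

lemma ae_not_isCoupled (hn : 1 ≤ n) (hs : 0 < C.noiseVar) {x y k : ℝ} (hx : 0 < x) (hy : 0 < y)
    (hk : 0 < k) :
    ∀ᵐ H : FadingState n, ¬ IsCoupled x y k (C.gains.fst H) (C.gains.snd H) (C.gains.gram H) := by
  have hswap : MeasurePreserving (Prod.swap : FadingState n → FadingState n) volume volume :=
    Measure.measurePreserving_swap
  filter_upwards [hswap.quasiMeasurePreserving.ae (ae_not_isCoupled_swap hn hs hx hy hk)] with H hH
  have hgram : C.gains.gram H.swap = C.gains.gram H := by
    simp [gains, real_inner_comm, mul_comm]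
  rwa [hgram] at hH

lemma isGeneric_gains (hn : 1 ≤ n) (hdensity : C.law ≪ volume) (hs : 0 < C.noiseVar) :
    C.gains.IsGeneric C.law where
  gram_lt := (ae_inner_ne_zero_of_absolutelyContinuous hn hdensity).mono
    fun _ => gains_gram_lt hs.ne'
  not_isCoupled _ _ _ hx hy hk := hdensity.ae_le (ae_not_isCoupled hn hs hx hy hk)
  not_isCoupled_swap _ _ _ hx hy hk := hdensity.ae_le (ae_not_isCoupled_swap hn hs hx hy hk)

lemma integrable_log_one_add_div {Ω : Type*} [MeasurableSpace Ω] {μ : Measure Ω}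
    [IsFiniteMeasure μ] {f : Ω → ℝ} {s : ℝ} (hs : 0 ≤ s) (hf : Measurable f) (hf0 : ∀ ω, 0 ≤ f ω)
    (hi : Integrable (fun ω => Real.log (1 + f ω)) μ) :
    Integrable (fun ω => Real.log (1 + f ω / s)) μ := by
  refine (hi.add (integrable_const (Real.log (1 + s⁻¹)))).mono'
    ((hf.div_const s).const_add 1).log.aestronglyMeasurable (.of_forall fun ω => ?_)
  rw [Real.norm_eq_abs, abs_of_nonneg (log_one_add_nonneg (div_nonneg (hf0 ω) hs))]
  exact log_one_add_mul_le (hf0 ω) (inv_nonneg.2 hs)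

lemma isRegular_gains [IsFiniteMeasure C.law] (hs : 0 < C.noiseVar)
    (hinner : ∀ᵐ H ∂C.law, ⟪H.1, H.2⟫ ≠ 0)
    (hlog₁ : Integrable (fun H : FadingState n => Real.log (1 + ‖H.1‖ ^ 2)) C.law)
    (hlog₂ : Integrable (fun H : FadingState n => Real.log (1 + ‖H.2‖ ^ 2)) C.law) :
    C.gains.IsRegular C.law where
  isGain_fst := ⟨continuous_gains_fst.measurable, gains_fst_nonneg hs.le,
    hinner.mono fun _ => gains_fst_pos hs,
    integrable_log_one_add_div hs.le (by fun_prop) (fun _ => sq_nonneg _) hlog₁⟩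
  isGain_snd := ⟨continuous_gains_snd.measurable, gains_snd_nonneg hs.le,
    hinner.mono fun _ => gains_snd_pos hs,
    integrable_log_one_add_div hs.le (by fun_prop) (fun _ => sq_nonneg _) hlog₂⟩
  measurable_gram := continuous_gains_gram.measurable
  gram_nonneg := gains_gram_nonneg
  gram_le H := by
    rw [← sub_nonneg, gains_mul_sub_gram]
    positivity

/-! ### Fading states at which both users gain by transmitting -/

section InnerProductSpace

variable {E : Type*} [NormedAddCommGroup E] [InnerProductSpace ℝ E] {u v w : E}

lemma eq_or_eq_neg_of_norm_eq_of_le_inner_sq (hu : u ≠ 0) (hw : w ≠ 0) (huv : ‖u‖ = ‖v‖)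
    (hcu : ‖u‖ ^ 2 * ‖w‖ ^ 2 ≤ ⟪u, w⟫ ^ 2) (hcv : ‖v‖ ^ 2 * ‖w‖ ^ 2 ≤ ⟪v, w⟫ ^ 2) :
    u = v ∨ u = -v := by
  have hparallel : ∀ z : E, z ≠ 0 → ‖z‖ ^ 2 * ‖w‖ ^ 2 ≤ ⟪z, w⟫ ^ 2 → ∃ r : ℝ, z = r • w := by
    intro z hz hcz
    have heq : ‖⟪w, z⟫‖ = ‖w‖ * ‖z‖ := (norm_inner_le_norm w z).antisymm <|
      le_of_pow_le_pow_left₀ two_ne_zero (norm_nonneg _)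
        (by rwa [Real.norm_eq_abs, sq_abs, real_inner_comm, mul_pow, mul_comm])
    obtain ⟨r, -, hr⟩ := (norm_inner_eq_norm_iff hw hz).1 heq
    exact ⟨r, hr⟩
  have hv : v ≠ 0 := norm_ne_zero_iff.1 (huv ▸ norm_ne_zero_iff.2 hu)
  obtain ⟨r, rfl⟩ := hparallel u hu hcu
  obtain ⟨s, rfl⟩ := hparallel v hv hcv
  rw [norm_smul, norm_smul, mul_left_inj' (norm_ne_zero_iff.2 hw), Real.norm_eq_abs,
    Real.norm_eq_abs] at huv
  rcases abs_eq_abs.1 huv with rfl | rfl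
  · exact Or.inl rfl
  · exact Or.inr (neg_smul s w)

/-- Spheres have no isolated points in dimension at least two, whereas only two antipodal points of
a sphere are parallel to `w`. -/
lemma exists_mem_norm_eq_inner_sq_lt (hE : 1 < Module.rank ℝ E) {U : Set E} (hU : IsOpen U)
    (huU : u ∈ U) (hu : u ≠ 0) (hw : w ≠ 0) :
    ∃ v ∈ U, ‖v‖ = ‖u‖ ∧ ⟪v, w⟫ ^ 2 < ‖v‖ ^ 2 * ‖w‖ ^ 2 := by
  have : IsAddTorsionFree E := .of_isTorsionFree ℝ E
  have hne : u ≠ -u := self_ne_neg.2 hu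
  have hsphere : Preperfect (Metric.sphere (0 : E) ‖u‖) :=
    (isPreconnected_sphere hE 0 ‖u‖).preperfect_of_nontrivial
      ⟨u, by simp, -u, by simp, hne⟩
  have hnhds : U ∩ {-u}ᶜ ∈ nhds u := (hU.inter isOpen_compl_singleton).mem_nhds ⟨huU, hne⟩
  obtain ⟨v, ⟨⟨hvU, hvneg⟩, hv⟩, hvu⟩ := accPt_iff_nhds.1 (hsphere u (by simp)) _ hnhds
  have hnorm : ‖v‖ = ‖u‖ := mem_sphere_zero_iff_norm.1 hv
  by_contra! hall
  rcases eq_or_eq_neg_of_norm_eq_of_le_inner_sq hu hw hnorm.symm (hall u huU rfl)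
    (hall v hvU hnorm) with h | h
  · exact hvu h.symm
  · exact hvneg (neg_eq_iff_eq_neg.1 h.symm)

end InnerProductSpace

lemma exists_apply_eq_apply_of_isPreconnected {X Y : Type*} [TopologicalSpace X]
    [TopologicalSpace Y] {f : X → ℝ} {g : Y → ℝ} {U : Set X} {V : Set Y} {c : ℝ}
    (hf : ContinuousOn f U) (hg : ContinuousOn g V) (hU : IsPreconnected U) (hV : IsPreconnected V)
    (hfg : ∃ u ∈ U, ∃ v ∈ V, c < f u ∧ g v ≤ f u) (hgf : ∃ u ∈ U, ∃ v ∈ V, c < g v ∧ f u ≤ g v) :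
    ∃ u ∈ U, ∃ v ∈ V, f u = g v ∧ c < f u := by
  obtain ⟨u, hu, v, hv, hcu, hvu⟩ := hfg
  obtain ⟨u', hu', v', hv', hcv', huv'⟩ := hgf
  rcases le_total (g v') (f u) with hle | hle
  · obtain ⟨z, hz, hzv⟩ := hU.intermediate_value hu' hu hf ⟨huv', hle⟩
    exact ⟨z, hz, v', hv', hzv, hzv ▸ hcv'⟩
  · obtain ⟨z, hz, hzu⟩ := hV.intermediate_value hv hv' hg ⟨hvu, hle⟩
    exact ⟨u, hu, z, hz, hzu.symm, hcu⟩

lemma frequently_mem_of_isOpen {X : Type*} [TopologicalSpace X] [MeasurableSpace X]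
    [OpensMeasurableSpace X] {μ ν : Measure X} [ν.IsOpenPosMeasure] {O W : Set X} (hO : IsOpen O)
    (hW : IsOpen W) (hWμ : ν.restrict W ≪ μ) (hne : (O ∩ W).Nonempty) : ∃ᵐ x ∂μ, x ∈ O := by
  intro hnull
  refine ((hO.inter hW).measure_pos ν hne).ne' ?_
  rw [← Measure.restrict_apply hO.measurableSet]
  exact hWμ (measure_eq_zero_iff_ae_notMem.2 hnull)

variable {x y : ℝ}

lemma isOpen_not_silences : IsOpen {H : FadingState n | 1 < x * C.gains.fst H ∧
    ¬ Silences x y (C.gains.fst H) (C.gains.snd H) (C.gains.gram H) ∧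
    ¬ Silences y x (C.gains.snd H) (C.gains.fst H) (C.gains.gram H)} := by
  simp only [Silences, not_le]
  refine IsOpen.and ?_ (IsOpen.and ?_ ?_) <;> exact isOpen_lt (by fun_prop) (by fun_prop)

lemma frequently_not_silences (hn : 2 ≤ n) (hs : 0 < C.noiseVar)
    (hsupp : C.HasConnectedProductSupport) (hx : 0 < x) (hy : 0 < y)
    (hfst : ∃ᵐ H ∂C.law, 1 < x * C.gains.fst H ∧ y * C.gains.snd H ≤ x * C.gains.fst H)
    (hsnd : ∃ᵐ H ∂C.law, 1 < y * C.gains.snd H ∧ x * C.gains.fst H ≤ y * C.gains.snd H) :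
    ∃ᵐ H ∂C.law, 1 < x * C.gains.fst H ∧
      ¬ Silences x y (C.gains.fst H) (C.gains.snd H) (C.gains.gram H) ∧
      ¬ Silences y x (C.gains.snd H) (C.gains.fst H) (C.gains.gram H) := by
  obtain ⟨U, V, hU, hUc, hV, hVc, hnull, hac⟩ := hsupp
  have hmem : ∀ᵐ H ∂C.law, H ∈ U ×ˢ V := mem_ae_iff.2 hnull
  obtain ⟨H, hH, hHU⟩ := (hfst.and_eventually hmem).exists
  obtain ⟨K, hK, hKU⟩ := (hsnd.and_eventually hmem).exists
  obtain ⟨u, hu, v, hv, huv, hone⟩ := exists_apply_eq_apply_of_isPreconnected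
    (f := fun h : EuclideanSpace ℝ (Fin n) => x * (‖h‖ ^ 2 / C.noiseVar))
    (g := fun h : EuclideanSpace ℝ (Fin n) => y * (‖h‖ ^ 2 / C.noiseVar)) (by fun_prop)
    (by fun_prop) hUc.isPreconnected hVc.isPreconnected ⟨H.1, hHU.1, H.2, hHU.2, hH⟩
    ⟨K.1, hKU.1, K.2, hKU.2, hK⟩
  have hu0 : u ≠ 0 := by rintro rfl; norm_num at hone
  have hv0 : v ≠ 0 := by rintro rfl; norm_num [huv] at hone
  have hrank : 1 < Module.rank ℝ (EuclideanSpace ℝ (Fin n)) := by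
    rw [rank_eq_card_basis (EuclideanSpace.basisFun (Fin n) ℝ).toBasis, Fintype.card_fin]
    exact_mod_cast hn
  obtain ⟨u', hu', hnorm, hlt⟩ := exists_mem_norm_eq_inner_sq_lt hrank hU hu hu0 hv0
  rw [← hnorm] at huv hone
  have hgram : 0 < C.gains.gram (u', v) := div_pos (sub_pos.2 hlt) (pow_pos hs 2)
  refine frequently_mem_of_isOpen isOpen_not_silences (hU.prod hV) hac ⟨(u', v), ⟨hone, ?_, ?_⟩,
    hu', hv⟩
  · exact not_silences_of_mul_eq hgram hy hone huv
  · exact not_silences_of_mul_eq hgram hx (hone.trans_eq huv) huv.symm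

/-! ### Rate pairs and the capacity region -/

section rates

variable {D : Set (FadingState n)} {P Q P' Q' : FadingState n → ℝ}

lemma sumInfo_le_sumInfo_iff (hs : C.noiseVar ≠ 0) : C.sumInfo P Q ≤ C.sumInfo P' Q' ↔
    C.gains.sumLog C.law P Q ≤ C.gains.sumLog C.law P' Q' := by
  rw [sumInfo_eq hs, sumInfo_eq hs, mul_le_mul_iff_right₀ bitRate_pos]

lemma sumInfo_zero_right (hs : C.noiseVar ≠ 0) :
    C.sumInfo P 0 = bitRate * logValue C.law C.gains.fst P := by
  rw [sumInfo_eq hs, GainPair.sumLog_zero_right]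

lemma sumInfo_zero_left (hs : C.noiseVar ≠ 0) :
    C.sumInfo 0 Q = bitRate * logValue C.law C.gains.snd Q := by
  rw [sumInfo_eq hs, ← GainPair.sumLog_swap, GainPair.sumLog_zero_right, GainPair.swap]

lemma rate₁_empty (hs : 0 < C.noiseVar) (hP : ∀ H, 0 ≤ P H) (hQ : ∀ H, 0 ≤ Q H) :
    C.rate₁ ∅ P Q = C.sumInfo P 0 := by
  rw [rate₁_eq hs ∅ hP hQ, sumInfo_zero_right hs.ne', GainPair.payoff,
    GainPair.interferedGain_empty]

lemma rate₂_univ (hs : 0 < C.noiseVar) (hP : ∀ H, 0 ≤ P H) (hQ : ∀ H, 0 ≤ Q H) :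
    C.rate₂ Set.univ P Q = C.sumInfo 0 Q := by
  rw [rate₂_eq hs Set.univ hP hQ, sumInfo_zero_left hs.ne', Set.compl_univ, GainPair.payoff,
    GainPair.interferedGain_empty, GainPair.swap]

lemma rate_add_rate (hs : 0 < C.noiseVar) (h : C.gains.IsRegular C.law) (hD : MeasurableSet D)
    {c₁ c₂ : ℝ} (hP : IsPolicy C.law c₁ P) (hQ : IsPolicy C.law c₂ Q) :
    C.rate₁ D P Q + C.rate₂ D P Q = C.sumInfo P Q := by
  rw [rate₁_eq hs D hP.nonneg hQ.nonneg, rate₂_eq hs D hP.nonneg hQ.nonneg, ← mul_add,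
    GainPair.payoff_add_payoff h hD hP hQ, sumInfo_eq hs.ne']

lemma rate_mem_capacityRegion (hs : 0 < C.noiseVar) (h : C.gains.IsRegular C.law)
    (hD : MeasurableSet D) (hP : IsPolicy C.law C.power₁ P) (hQ : IsPolicy C.law C.power₂ Q) :
    (C.rate₁ D P Q, C.rate₂ D P Q) ∈ C.capacityRegion := by
  have hsum := (rate_add_rate hs h hD hP hQ).le
  have hrate₁ := rate₁_eq hs D hP.nonneg hQ.nonneg
  have hrate₂ := rate₂_eq hs D hP.nonneg hQ.nonneg
  refine ⟨?_, ?_, P, Q, isFeasible_iff_isPolicy.2 hP, isFeasible_iff_isPolicy.2 hQ, ?_, ?_, hsum⟩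
  · rw [hrate₁]
    exact mul_nonneg bitRate_pos.le (h.payoff_nonneg hP.nonneg hQ.nonneg)
  · rw [hrate₂]
    exact mul_nonneg bitRate_pos.le (h.swap.payoff_nonneg hQ.nonneg hP.nonneg)
  · rw [hrate₁, sumInfo_zero_right hs.ne']
    exact mul_le_mul_of_nonneg_left (h.payoff_le_logValue hD hP hQ.measurable hQ.nonneg)
      bitRate_pos.le
  · rw [hrate₂, sumInfo_zero_left hs.ne']
    exact mul_le_mul_of_nonneg_left (h.swap.payoff_le_logValue hD.compl hQ hP.measurable hP.nonneg)
      bitRate_pos.le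

lemma isMaxSumRatePoint_iff (hs : 0 < C.noiseVar) (h : C.gains.IsRegular C.law)
    (hD : MeasurableSet D) (hP : IsPolicy C.law C.power₁ P) (hQ : IsPolicy C.law C.power₂ Q) :
    C.IsMaxSumRatePoint (C.rate₁ D P Q, C.rate₂ D P Q) ↔
      C.gains.IsSumLogMax C.law C.power₁ C.power₂ P Q := by
  constructor
  · rintro ⟨-, hmax⟩
    refine ⟨hP, hQ, fun P' Q' hP' hQ' => ?_⟩
    have hle := hmax _ (rate_mem_capacityRegion hs h hD hP' hQ')
    rw [rate_add_rate hs h hD hP' hQ', rate_add_rate hs h hD hP hQ] at hle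
    exact (sumInfo_le_sumInfo_iff hs.ne').1 hle
  · refine fun hmax => ⟨rate_mem_capacityRegion hs h hD hP hQ, ?_⟩
    rintro r ⟨-, -, P', Q', hP', hQ', -, -, hle⟩
    rw [rate_add_rate hs h hD hP hQ]
    exact hle.trans <| (sumInfo_le_sumInfo_iff hs.ne').2 <|
      hmax.le P' Q' (isFeasible_iff_isPolicy.1 hP') (isFeasible_iff_isPolicy.1 hQ')

lemma isCornerPoint₁_of_isNash [IsFiniteMeasure C.law] [NeZero C.law] (hs : 0 < C.noiseVar)
    (h : C.gains.IsRegular C.law) (hc : 0 < C.power₁) (hN : C.IsNash ∅ P Q) :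
    C.IsCornerPoint₁ (C.rate₁ ∅ P Q, C.rate₂ ∅ P Q) := by
  have hP := isFeasible_iff_isPolicy.1 hN.feasible₁
  have hQ := isFeasible_iff_isPolicy.1 hN.feasible₂
  refine ⟨rate_mem_capacityRegion hs h MeasurableSet.empty hP hQ, ?_⟩
  rintro r ⟨-, -, P', Q', hP', hQ', hle, -, hsum⟩
  refine ⟨hle.trans ?_, fun heq => ?_⟩
  · have hbest := hN.best₁ P' hP'
    rwa [rate₁_empty hs hP'.nonneg hQ.nonneg] at hbest
  · have hrate := rate_add_rate hs h MeasurableSet.empty hP hQ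
    dsimp only at heq ⊢
    rw [heq, rate₁_empty hs hP.nonneg hQ.nonneg, sumInfo_zero_right hs.ne',
      sumInfo_zero_right hs.ne', mul_le_mul_iff_right₀ bitRate_pos] at hle
    have hmax := (sumInfo_le_sumInfo_iff hs.ne').2 <|
      ((isNash_iff_isEquilibrium hs).1 hN).sumLog_le_of_logValue_le h hc
        (isFeasible_iff_isPolicy.1 hP') (isFeasible_iff_isPolicy.1 hQ') hle
    linarith

lemma isCornerPoint₂_of_isNash [IsFiniteMeasure C.law] [NeZero C.law] (hs : 0 < C.noiseVar)
    (h : C.gains.IsRegular C.law) (hc : 0 < C.power₂) (hN : C.IsNash Set.univ P Q) :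
    C.IsCornerPoint₂ (C.rate₁ Set.univ P Q, C.rate₂ Set.univ P Q) := by
  have hP := isFeasible_iff_isPolicy.1 hN.feasible₁
  have hQ := isFeasible_iff_isPolicy.1 hN.feasible₂
  refine ⟨rate_mem_capacityRegion hs h MeasurableSet.univ hP hQ, ?_⟩
  rintro r ⟨-, -, P', Q', hP', hQ', -, hle, hsum⟩
  refine ⟨hle.trans ?_, fun heq => ?_⟩
  · have hbest := hN.best₂ Q' hQ'
    rwa [rate₂_univ hs hP.nonneg hQ'.nonneg] at hbest
  · have hrate := rate_add_rate hs h MeasurableSet.univ hP hQ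
    dsimp only at heq ⊢
    rw [heq, rate₂_univ hs hP.nonneg hQ.nonneg, sumInfo_zero_left hs.ne',
      sumInfo_zero_left hs.ne', mul_le_mul_iff_right₀ bitRate_pos] at hle
    have hE := ((isNash_iff_isEquilibrium hs).1 hN).swap
    rw [Set.compl_univ] at hE
    have hmax := hE.sumLog_le_of_logValue_le h.swap hc (isFeasible_iff_isPolicy.1 hQ')
      (isFeasible_iff_isPolicy.1 hP') hle
    rw [GainPair.sumLog_swap, GainPair.sumLog_swap, ← sumInfo_le_sumInfo_iff hs.ne'] at hmax
    linarith

lemma exists_isNash_dominating [IsFiniteMeasure C.law] [NeZero C.law] (hs : 0 < C.noiseVar)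
    (h : C.gains.IsRegular C.law) (hc₁ : 0 < C.power₁) (hc₂ : 0 < C.power₂)
    (hD : MeasurableSet D) :
    ∃ P Q, C.IsNash D P Q ∧ ∀ P' Q', C.IsNash D P' Q' →
      (C.rate₁ D P' Q' ≤ C.rate₁ D P Q ∧ C.rate₂ D P' Q' ≤ C.rate₂ D P Q) ∧
      (C.rate₁ D P Q ≤ C.rate₁ D P' Q' → P' =ᵐ[C.law] P) ∧
      (C.rate₂ D P Q ≤ C.rate₂ D P' Q' → Q' =ᵐ[C.law] Q) := by
  obtain ⟨P, Q, hE, hdom⟩ := GainPair.exists_isEquilibrium_dominating h hD hc₁ hc₂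
  have hN := (isNash_iff_isEquilibrium hs).2 hE
  refine ⟨P, Q, hN, fun P' Q' hN' => ?_⟩
  rw [rate₁_eq hs D hN.feasible₁.nonneg hN.feasible₂.nonneg,
    rate₂_eq hs D hN.feasible₁.nonneg hN.feasible₂.nonneg,
    rate₁_eq hs D hN'.feasible₁.nonneg hN'.feasible₂.nonneg,
    rate₂_eq hs D hN'.feasible₁.nonneg hN'.feasible₂.nonneg]
  simp only [mul_le_mul_iff_right₀ bitRate_pos]
  exact hdom P' Q' ((isNash_iff_isEquilibrium hs).1 hN')

lemma exists_unique_isAdmissibleNash [IsFiniteMeasure C.law] [NeZero C.law]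
    (hs : 0 < C.noiseVar) (h : C.gains.IsRegular C.law) (hc₁ : 0 < C.power₁)
    (hc₂ : 0 < C.power₂) (hD : MeasurableSet D) :
    ∃ P Q, C.IsAdmissibleNash D P Q ∧
      ∀ P' Q', C.IsAdmissibleNash D P' Q' → P' =ᵐ[C.law] P ∧ Q' =ᵐ[C.law] Q := by
  obtain ⟨P, Q, hN, hdom⟩ := exists_isNash_dominating hs h hc₁ hc₂ hD
  refine ⟨P, Q, ⟨hN, ?_⟩, fun P' Q' hN' => ?_⟩
  · rintro ⟨P', Q', hN', -, -, hlt | hlt⟩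
    · exact hlt.not_ge (hdom P' Q' hN').1.1
    · exact hlt.not_ge (hdom P' Q' hN').1.2
  · obtain ⟨⟨hle₁, hle₂⟩, heq₁, heq₂⟩ := hdom P' Q' hN'.1
    exact ⟨heq₁ (not_lt.1 fun hlt => hN'.2 ⟨P, Q, hN, hle₁, hle₂, Or.inl hlt⟩),
      heq₂ (not_lt.1 fun hlt => hN'.2 ⟨P, Q, hN, hle₁, hle₂, Or.inr hlt⟩)⟩

lemma exists_isMaxSumRatePoint [IsFiniteMeasure C.law] (hs : 0 < C.noiseVar)
    (h : C.gains.IsRegular C.law) (hc₁ : 0 < C.power₁) (hc₂ : 0 < C.power₂) :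
    ∃ r, C.IsMaxSumRatePoint r := by
  obtain ⟨P, Q, hmax⟩ := h.exists_isSumLogMax hc₁.le hc₂.le
  exact ⟨_, (isMaxSumRatePoint_iff hs h MeasurableSet.empty hmax.isPolicy_fst
    hmax.isPolicy_snd).2 hmax⟩

lemma IsNash.isSumLogMax (hN : C.IsNash D P Q) (hs : 0 < C.noiseVar)
    (h : C.gains.IsRegular C.law) (hD : MeasurableSet D)
    (hmax : C.IsMaxSumRatePoint (C.rate₁ D P Q, C.rate₂ D P Q)) :
    C.gains.IsSumLogMax C.law C.power₁ C.power₂ P Q :=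
  (isMaxSumRatePoint_iff hs h hD (isFeasible_iff_isPolicy.1 hN.feasible₁)
    (isFeasible_iff_isPolicy.1 hN.feasible₂)).1 hmax

section stackelberg

variable [IsFiniteMeasure C.law] [NeZero C.law]

lemma exists_mem_stackelbergRegion_isCornerPoint₁ (hs : 0 < C.noiseVar)
    (h : C.gains.IsRegular C.law) (hc₁ : 0 < C.power₁) (hc₂ : 0 < C.power₂) :
    ∃ r ∈ C.stackelbergRegion, C.IsCornerPoint₁ r := by
  obtain ⟨P, Q, hN, -⟩ := exists_unique_isAdmissibleNash hs h hc₁ hc₂ MeasurableSet.empty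
  exact ⟨_, ⟨∅, P, Q, MeasurableSet.empty, hN, rfl⟩, isCornerPoint₁_of_isNash hs h hc₁ hN.1⟩

lemma exists_mem_stackelbergRegion_isCornerPoint₂ (hs : 0 < C.noiseVar)
    (h : C.gains.IsRegular C.law) (hc₁ : 0 < C.power₁) (hc₂ : 0 < C.power₂) :
    ∃ r ∈ C.stackelbergRegion, C.IsCornerPoint₂ r := by
  obtain ⟨P, Q, hN, -⟩ := exists_unique_isAdmissibleNash hs h hc₁ hc₂ MeasurableSet.univ
  exact ⟨_, ⟨Set.univ, P, Q, MeasurableSet.univ, hN, rfl⟩,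
    isCornerPoint₂_of_isNash hs h hc₂ hN.1⟩

lemma IsNash.ae_eq_zero_or_eq_zero (hN : C.IsNash D P Q) (hs : 0 < C.noiseVar)
    (h : C.gains.IsRegular C.law) (hG : C.gains.IsGeneric C.law) (hc₁ : 0 < C.power₁)
    (hc₂ : 0 < C.power₂) (hD : MeasurableSet D)
    (hmax : C.IsMaxSumRatePoint (C.rate₁ D P Q, C.rate₂ D P Q)) :
    ∀ᵐ H ∂C.law, P H = 0 ∨ Q H = 0 :=
  ((isNash_iff_isEquilibrium hs).1 hN).ae_eq_zero_or_eq_zero h hG hD hc₁ hc₂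
    (hN.isSumLogMax hs h hD hmax)

theorem not_isMaxSumRatePoint_of_mem_stackelbergRegion (hn : 2 ≤ n) (hs : 0 < C.noiseVar)
    (h : C.gains.IsRegular C.law) (hG : C.gains.IsGeneric C.law) (hc₁ : 0 < C.power₁)
    (hc₂ : 0 < C.power₂) (hsupp : C.HasConnectedProductSupport) {r : ℝ × ℝ}
    (hr : r ∈ C.stackelbergRegion) : ¬ C.IsMaxSumRatePoint r := by
  intro hmax
  obtain ⟨D, P, Q, hD, ⟨hN, -⟩, rfl⟩ := hr
  obtain ⟨x, y, hx, hy, hsilences, hfst, hsnd⟩ :=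
    (hN.isSumLogMax hs h hD hmax).exists_levels_silences h hc₁ hc₂
      (hN.ae_eq_zero_or_eq_zero hs h hG hc₁ hc₂ hD hmax)
  obtain ⟨H, ⟨htransmits, hnot₁, hnot₂⟩, himp⟩ :=
    ((frequently_not_silences hn hs hsupp hx hy hfst hsnd).and_eventually hsilences).exists
  exact (himp htransmits).elim hnot₁ hnot₂

end stackelberg

end rates

end VectorMAC

theorem mainTheorem7 {n : ℕ} (hn : 1 ≤ n) (C : VectorMAC n)
    (hprob : IsProbabilityMeasure C.law)
    (hdensity : C.law ≪ volume)
    (hlog₁ : Integrable (fun H : FadingState n => Real.log (1 + ‖H.1‖ ^ 2)) C.law)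
    (hlog₂ : Integrable (fun H : FadingState n => Real.log (1 + ‖H.2‖ ^ 2)) C.law)
    (hnoise : 0 < C.noiseVar) (hpower₁ : 0 < C.power₁) (hpower₂ : 0 < C.power₂) :
    -- for every base-station strategy, a unique (almost surely) admissible Nash equilibrium
    (∀ D : Set (FadingState n), MeasurableSet D →
      ∃ P₁ P₂, C.IsAdmissibleNash D P₁ P₂ ∧
        ∀ Q₁ Q₂, C.IsAdmissibleNash D Q₁ Q₂ → Q₁ =ᵐ[C.law] P₁ ∧ Q₂ =ᵐ[C.law] P₂) ∧
    -- both corner points are achieved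
    (∃ r ∈ C.stackelbergRegion, C.IsCornerPoint₁ r) ∧
    (∃ r ∈ C.stackelbergRegion, C.IsCornerPoint₂ r) ∧
    -- the maximum sum-rate is attained in the capacity region
    (∃ r, C.IsMaxSumRatePoint r) ∧
    -- an equilibrium of the game could attain it only by time sharing
    (∀ (D : Set (FadingState n)) (P₁ P₂ : FadingState n → ℝ), MeasurableSet D →
      C.IsAdmissibleNash D P₁ P₂ →
      C.IsMaxSumRatePoint (C.rate₁ D P₁ P₂, C.rate₂ D P₁ P₂) →
      ∀ᵐ H ∂C.law, P₁ H = 0 ∨ P₂ H = 0) ∧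
    -- with at least two antennas and non-degenerate fading it is never attained by the game
    (2 ≤ n → C.HasConnectedProductSupport →
      ∀ r ∈ C.stackelbergRegion, ¬ C.IsMaxSumRatePoint r) := by
  have h := VectorMAC.isRegular_gains hnoise
    (VectorMAC.ae_inner_ne_zero_of_absolutelyContinuous hn hdensity) hlog₁ hlog₂
  have hG := VectorMAC.isGeneric_gains hn hdensity hnoise
  exact
    ⟨fun D hD => VectorMAC.exists_unique_isAdmissibleNash hnoise h hpower₁ hpower₂ hD,
      VectorMAC.exists_mem_stackelbergRegion_isCornerPoint₁ hnoise h hpower₁ hpower₂,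
      VectorMAC.exists_mem_stackelbergRegion_isCornerPoint₂ hnoise h hpower₁ hpower₂,
      VectorMAC.exists_isMaxSumRatePoint hnoise h hpower₁ hpower₂,
      fun D P Q hD hN hmax => hN.1.ae_eq_zero_or_eq_zero hnoise h hG hpower₁ hpower₂ hD hmax,
      fun hn₂ hsupp r hr => VectorMAC.not_isMaxSumRatePoint_of_mem_stackelbergRegion
        hn₂ hnoise h hG hpower₁ hpower₂ hsupp hr⟩
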